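/- **Setting.** Let $r\ge 1$, $m\ge 2$, $n$ be integers and let $\mathcal X$ consist of $n$ nodes for each pair of a domain in $[m]$ and a class in $[r]$, so $|\mathcal X|=N=rmn$; write $d_x$ and $y_x$ for the domain and class of $x$. Let $0\le\gamma$, $\rho\le 1$, $\rho>\max\{\alpha,\beta\}$ and $\min\{\alpha,\beta\}>\gamma$. A random undirected graph on $\mathcal X$ contains each unordered pair $\{x,x'\}$ (including $x=x'$) independently with probability $\rho$ if $y_x=y_{x'},d_x=d_{x'}$; $\alpha$ if $y_x=y_{x'},d_x\ne d_{x'}$; $\beta$ if $y_x\ne y_{x'},d_x=d_{x'}$; $\gamma$ if $y_x\ne y_{x'},d_x\ne d_{x'}$. Let $A$ be its adjacency matrix. Let $f:\mathcal X\to\mathbb R^{k}$, $k=r+m-1$, be any minimizer of the spectral contrastive loss $$-2\sum_{x,x'}\frac{A_{xx'}}{\sum_{z,z'}A_{zz'}}\,f(x)^\top f(x')+\frac1{N^2}\sum_{x,x'}\big(f(x)^\top f(x')\big)^2 .$$ Let $\mathcal S=\{x:d_x=1\}$ (source), $\mathcal T=\{x:d_x\neq1\}$ (target), $\vec y_x=e_{y_x}-\frac1r\mathbf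 1\in\mathbb R^r$, and let $\hat b\in\mathbb R^{k\times r}$ minimize $\sum_{x\in\mathcal S}\big(\|b^\top f(x)-\vec y_x\|_2^2+\eta\|b\|_F^2\big)$. Let $\mathrm{pred}(x)\in\arg\max_i(\hat b^\top f(x))_i$, with ties broken arbitrarily. Put $\delta=\min\{\alpha-\gamma,\beta-\gamma\}=\min\{\alpha,\beta\}-\gamma$. **Theorem (general case).** There is an absolute exponent $D\in\mathbb N$ such that for all $\zeta>0$ and $\epsilon\in(0,\frac12)$ there are constants $C_1,C_2>0$, depending only on $\zeta,\epsilon$, with the following property. For all $r,m,\rho,\alpha,\beta,\gamma$ as above and every $\eta\in\big(0,\frac{(\alpha-\gamma)\epsilon}{2r\rho}\big]$ there is $\tilde\xi\in[1-\epsilon,1]$ (not depending on $n$) such that for every $n\ge C_1\frac{rm}{\delta^2}$, with probability at least $1-n^{-\zeta}$, $$\sum_{x\in\mathcal T}\big\|\hat b^\top f(x)-\tilde\xi\,\vec y_x\big\|_2^2\le\frac{C_2}{\eta^4\delta^2}(rm)^D\qquad\text{and}\qquad \Pr_{x\sim\mathcal T}\big(\mathrm{pred}(x)\ne y_x\big)\le\frac{C_2}{\eta^4\delta^2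 n}(rm)^D,$$ where $x\sim\mathcal T$ is uniform. **Theorem (two domains).** There are an absolute exponent $D$ and absolute constants $C_1,C_2>0$ such that for $m=2$, $k=r+1$, every $\eta\in\big(0,\frac{\alpha-\gamma}{8r\rho}\big)$ and every $n\ge C_1\frac{r}{\delta^2}$, with probability at least $0.999$, $$\Pr_{x\sim\mathcal T}\big(\mathrm{pred}(x)\neq y_x\big)\le\frac{C_2}{\eta^4(\min\{\alpha,\beta\}-\gamma)^2n}\,r^D .$$ -/

import Mathlib

/-!
Stochastic block model on classes and domains, spectral contrastive pre-training on the sampled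
graph, and the ridge-regularized least-squares head fitted on the source domain.
-/

namespace SBM

/-- The nodes: `n` data points for each of the `m` domains and `r` classes. -/
abbrev Node (r m n : ℕ) : Type := Fin m × Fin r × Fin n

/-- The domain of a node. -/
def dom {r m n : ℕ} (x : Node r m n) : Fin m := x.1

/-- The class of a node. -/
def cls {r m n : ℕ} (x : Node r m n) : Fin r := x.2.1

/-- The source data: the nodes of the first domain. -/
def source (r m n : ℕ) : Finset (Node r m n) :=
  Finset.univ.filter fun x => (dom x : ℕ) = 0

/-- The target data: the nodes of all other domains. -/
def target (r m n : ℕ) : Finset (Node r m n) :=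
  Finset.univ.filter fun x => (dom x : ℕ) ≠ 0

/-- The probability of an edge between `x` and `x'`. -/
def pairProb {r m n : ℕ} (ρ α β γ : ℝ) (x x' : Node r m n) : ℝ :=
  if cls x = cls x' then (if dom x = dom x' then ρ else α)
  else (if dom x = dom x' then β else γ)

theorem pairProb_comm {r m n : ℕ} (ρ α β γ : ℝ) (x x' : Node r m n) :
    pairProb ρ α β γ x x' = pairProb ρ α β γ x' x := by
  simp only [pairProb, eq_comm]

/-- The edge probability as a function of the unordered pair of end points. -/
def edgeProb {r m n : ℕ} (ρ α β γ : ℝ) : Sym2 (Node r m n) → ℝ :=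
  Sym2.lift ⟨pairProb ρ α β γ, pairProb_comm ρ α β γ⟩

/-- An undirected unweighted graph on the nodes: it says for every unordered pair `{x, x'}`
(`x = x'` is allowed) whether it is an edge. -/
abbrev Graph (r m n : ℕ) : Type := Sym2 (Node r m n) → Bool

/-- The Bernoulli law with success probability `p ∈ [0, 1]`. -/
noncomputable def bernoulliLaw (p : ℝ) : MeasureTheory.Measure Bool :=
  ENNReal.ofReal p • MeasureTheory.Measure.dirac true +
    ENNReal.ofReal (1 - p) • MeasureTheory.Measure.dirac false

/-- The law of the random graph: the edges are independent Bernoulli variables. -/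
noncomputable def graphLaw (r m n : ℕ) (ρ α β γ : ℝ) : MeasureTheory.Measure (Graph r m n) :=
  MeasureTheory.Measure.pi fun e => bernoulliLaw (edgeProb ρ α β γ e)

/-- The adjacency matrix. -/
def adj {r m n : ℕ} (g : Graph r m n) : Matrix (Node r m n) (Node r m n) ℝ :=
  Matrix.of fun x x' => if g s(x, x') then 1 else 0

/-- The probability of the positive pair `(x, x')`: positive pairs are uniform random edges. -/
noncomputable def posPair {r m n : ℕ} (g : Graph r m n) (x x' : Node r m n) : ℝ :=
  adj g x x' / ∑ z, ∑ z', adj g z z'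

/-- The population spectral contrastive loss of a feature map `f` into `ℝ^k`; negative pairs are
two independent uniform random nodes. -/
noncomputable def contrastiveLoss {r m n k : ℕ} (g : Graph r m n)
    (f : Node r m n → Fin k → ℝ) : ℝ :=
  -2 * ∑ x, ∑ x', posPair g x x' * (f x ⬝ᵥ f x') +
    ∑ x, ∑ x', 1 / (Fintype.card (Node r m n) : ℝ) ^ 2 * (f x ⬝ᵥ f x') ^ 2

/-- `f` is learned by pre-training on `g`: it minimizes the spectral contrastive loss. -/
def IsPretrained {r m n k : ℕ} (g : Graph r m n) (f : Node r m n → Fin k → ℝ) : Prop :=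
  ∀ f' : Node r m n → Fin k → ℝ, contrastiveLoss g f ≤ contrastiveLoss g f'

/-- The mean-zero one-hot embedding `e_{y_x} - (1/r) 𝟙` of the class of `x`. -/
noncomputable def label {r m n : ℕ} (x : Node r m n) : Fin r → ℝ :=
  fun i => (if i = cls x then 1 else 0) - 1 / (r : ℝ)

/-- The scores `bᵀ f(x)` of a linear head `b` on the features `f`. -/
def score {r m n k : ℕ} (f : Node r m n → Fin k → ℝ) (b : Matrix (Fin k) (Fin r) ℝ)
    (x : Node r m n) : Fin r → ℝ :=
  Matrix.mulVec b.transpose (f x)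

/-- The squared loss on the source data with ridge regularization of strength `η`. -/
noncomputable def headLoss {r m n k : ℕ} (η : ℝ) (f : Node r m n → Fin k → ℝ)
    (b : Matrix (Fin k) (Fin r) ℝ) : ℝ :=
  ∑ x ∈ source r m n, (∑ i, (score f b x i - label x i) ^ 2 + η * ∑ j, ∑ i, b j i ^ 2)

/-- `b` is the linear head learned on the source data. -/
def IsHead {r m n k : ℕ} (η : ℝ) (f : Node r m n → Fin k → ℝ)
    (b : Matrix (Fin k) (Fin r) ℝ) : Prop :=
  ∀ b' : Matrix (Fin k) (Fin r) ℝ, headLoss η f b ≤ headLoss η f b'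

/-- `pred` predicts a class of maximal score (with an arbitrary choice among ties). -/
def IsPredictor {r m n k : ℕ} (f : Node r m n → Fin k → ℝ) (b : Matrix (Fin k) (Fin r) ℝ)
    (pred : Node r m n → Fin r) : Prop :=
  ∀ x i, score f b x i ≤ score f b x (pred x)

/-- The 0-1 error of a predictor under the uniform distribution on the target data. -/
noncomputable def targetError {r m n : ℕ} (pred : Node r m n → Fin r) : ℝ :=
  (((target r m n).filter fun x => pred x ≠ cls x).card : ℝ) / ((target r m n).card : ℝ)

end SBM

/-!
The matrix of edge probabilities has four eigenvalues: on constants, on class contrasts, on domain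
contrasts, and on the interactions of class and domain. By Hoeffding's inequality on a net of the
unit ball, the sampled adjacency matrix differs from it by `O(√N)` in operator norm, whereas the
first three eigenvalues are at least `n δ` and exceed the fourth by at least `n δ`; that the fourth
may be very negative does no harm, since Gram matrices are positive semidefinite. Up to a constant,
the contrastive loss is the squared Frobenius distance from a multiple of the Gram matrix of the
features to the adjacency matrix, so the Gram matrix of a minimizer is close to a multiple `K` of
the signal part, that is, of the probability matrix without its interactions, which has rank
`r + m - 1`. The scores of the ridge head depend on the features only through their Gram matrix, and
stably so; if the Gram matrix were `K` itself, they would be the labels of all nodes, shrunk by one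
factor.
-/

open Matrix

section Frobenius

open scoped Matrix.Norms.Frobenius

variable {ι κ : Type*} [Fintype ι] [Fintype κ]

theorem frobenius_norm_sq (X : Matrix ι κ ℝ) : ‖X‖ ^ 2 = ∑ i, ∑ j, X i j ^ 2 := by
  rw [frobenius_norm_def, ← Real.sqrt_eq_rpow, Real.sq_sqrt (by positivity)]
  simp only [Real.norm_eq_abs, Real.rpow_two, sq_abs]

theorem frobenius_norm_sq_eq_trace (X : Matrix ι κ ℝ) : ‖X‖ ^ 2 = trace (Xᵀ * X) := by
  rw [frobenius_norm_sq, Finset.sum_comm]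
  simp only [trace, diag_apply, mul_apply, transpose_apply, sq]

theorem frobenius_norm_add_sq (X Y : Matrix ι κ ℝ) :
    ‖X + Y‖ ^ 2 = ‖X‖ ^ 2 + 2 * trace (Xᵀ * Y) + ‖Y‖ ^ 2 := by
  have hsymm : trace (Yᵀ * X) = trace (Xᵀ * Y) := by
    rw [← trace_transpose, transpose_mul, transpose_transpose]
  simp only [frobenius_norm_sq_eq_trace, transpose_add, Matrix.add_mul, Matrix.mul_add, trace_add,
    hsymm]
  ring

theorem frobenius_norm_sub_sq (X Y : Matrix ι κ ℝ) :
    ‖X - Y‖ ^ 2 = ‖X‖ ^ 2 - 2 * trace (Xᵀ * Y) + ‖Y‖ ^ 2 := by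
  rw [sub_eq_add_neg, frobenius_norm_add_sq, Matrix.mul_neg, trace_neg, norm_neg]
  ring

theorem abs_trace_transpose_mul_le (X Y : Matrix ι κ ℝ) : |trace (Xᵀ * Y)| ≤ ‖X‖ * ‖Y‖ := by
  refine abs_le_of_sq_le_sq ?_ (by positivity)
  have h : trace (Xᵀ * Y) = ∑ p : ι × κ, X p.1 p.2 * Y p.1 p.2 := by
    rw [Fintype.sum_prod_type, Finset.sum_comm]
    rfl
  rw [h, mul_pow, frobenius_norm_sq, frobenius_norm_sq, ← Fintype.sum_prod_type',
    ← Fintype.sum_prod_type']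
  exact Finset.sum_mul_sq_le_sq_mul_sq _ _ _

theorem frobenius_norm_sq_of_isIdempotentElem {P : Matrix ι ι ℝ} (hP : P.IsSymm)
    (hPP : IsIdempotentElem P) : ‖P‖ ^ 2 = trace P := by
  rw [frobenius_norm_sq_eq_trace, hP, hPP]

end Frobenius

section Rank

open scoped Matrix.Norms.Frobenius

variable {ι κ : Type*} [Fintype ι]

theorem rank_sub_le (X Y : Matrix κ ι ℝ) : (X - Y).rank ≤ X.rank + Y.rank := by
  have h : LinearMap.range (X - Y).mulVecLin ≤
      LinearMap.range X.mulVecLin ⊔ LinearMap.range Y.mulVecLin := by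
    rintro _ ⟨v, rfl⟩
    rw [mulVecLin_apply, sub_mulVec]
    exact Submodule.sub_mem_sup ⟨v, rfl⟩ ⟨v, rfl⟩
  exact (Submodule.finrank_mono h).trans (Submodule.finrank_add_le_finrank_add_finrank _ _)

theorem rank_eq_trace_of_isIdempotentElem {P : Matrix ι ι ℝ} (hP : IsIdempotentElem P) :
    (P.rank : ℝ) = trace P := by
  classical
  have h : IsIdempotentElem P.toLin' := by
    rw [IsIdempotentElem, Module.End.mul_eq_comp, ← toLin'_mul, hP]
  rw [← trace_toLin'_eq, ((LinearMap.isProj_range_iff_isIdempotentElem _).2 h).trace]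
  rfl

theorem exists_projection_mul_eq_self [Finite κ] (X : Matrix κ ι ℝ) :
    ∃ P : Matrix ι ι ℝ, P.IsSymm ∧ IsIdempotentElem P ∧ trace P = X.rank ∧ X * P = X := by
  classical
  have := Fintype.ofFinite κ
  have hX : (Xᵀ * X).IsHermitian := isHermitian_conjTranspose_mul_self X
  set U : Matrix ι ι ℝ := (hX.eigenvectorUnitary : Matrix ι ι ℝ)
  set D : Matrix ι ι ℝ := diagonal fun i => if hX.eigenvalues i = 0 then 0 else 1 with hD
  have hUU : Uᵀ * U = 1 := Unitary.coe_star_mul_self hX.eigenvectorUnitary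
  have hUU' : U * Uᵀ = 1 := Unitary.coe_mul_star_self hX.eigenvectorUnitary
  have hspec : Xᵀ * X = U * diagonal hX.eigenvalues * Uᵀ := by
    have := hX.spectral_theorem
    rwa [Unitary.conjStarAlgAut_apply] at this
  have hDD : D * D = D := by simp [hD]
  refine ⟨U * D * Uᵀ, ?_, ?_, ?_, ?_⟩
  · simp [IsSymm, hD, Matrix.mul_assoc]
  · calc U * D * Uᵀ * (U * D * Uᵀ) = U * (D * (Uᵀ * U) * D) * Uᵀ := by
          simp only [Matrix.mul_assoc]
      _ = U * D * Uᵀ := by rw [hUU, Matrix.mul_one, hDD]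
  · rw [trace_mul_comm, ← Matrix.mul_assoc, hUU, Matrix.one_mul, trace_diagonal,
      ← rank_transpose_mul_self, hX.rank_eq_card_non_zero_eigs, Fintype.card_subtype]
    simp [Finset.sum_ite]
  · have hXU : X * (U * (1 - D)) = 0 := by
      have hzero : diagonal hX.eigenvalues * (1 - D) = 0 := by
        rw [hD, ← diagonal_one, diagonal_sub, diagonal_mul_diagonal, diagonal_eq_zero]
        ext i
        by_cases hi : hX.eigenvalues i = 0 <;> simp [hi]
      refine (conjTranspose_mul_self_mul_eq_zero X _).1 ?_
      rw [conjTranspose_eq_transpose_of_trivial, hspec, Matrix.mul_assoc, ← Matrix.mul_assoc Uᵀ,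
        hUU, Matrix.one_mul, Matrix.mul_assoc, hzero, Matrix.mul_zero]
    have hXUD : X * U = X * (U * D) := by simpa [Matrix.mul_sub, sub_eq_zero] using hXU
    rw [← Matrix.mul_assoc, ← hXUD, Matrix.mul_assoc, hUU', Matrix.mul_one]

theorem exists_mul_transpose_eq {B : Matrix ι ι ℝ} (hB : B.PosSemidef) {k : ℕ}
    (hk : B.rank ≤ k) : ∃ V : Matrix ι (Fin k) ℝ, V * Vᵀ = B := by
  classical
  set U : Matrix ι ι ℝ := (hB.isHermitian.eigenvectorUnitary : Matrix ι ι ℝ)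
  set lam := hB.isHermitian.eigenvalues
  have hspec : B = U * diagonal lam * Uᵀ := by
    have := hB.isHermitian.spectral_theorem
    rwa [Unitary.conjStarAlgAut_apply] at this
  obtain ⟨φ⟩ : Nonempty ({i // lam i ≠ 0} ↪ Fin k) := by
    refine Function.Embedding.nonempty_of_card_le ?_
    rwa [← hB.isHermitian.rank_eq_card_non_zero_eigs, Fintype.card_fin]
  let W : Matrix ι {i // lam i ≠ 0} ℝ := of fun x i => √(lam i) * U x i
  let E : Matrix {i // lam i ≠ 0} (Fin k) ℝ := (1 : Matrix (Fin k) (Fin k) ℝ).submatrix φ id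
  have hE : E * Eᵀ = 1 := by
    rw [transpose_submatrix, transpose_one, ← submatrix_mul _ _ _ _ _ Function.bijective_id,
      Matrix.one_mul, submatrix_one_embedding]
  have hW : W * Wᵀ = B := by
    ext x y
    rw [hspec, mul_apply, mul_apply]
    refine Fintype.sum_of_injective _ Subtype.val_injective _ _ (fun j hj => ?_) fun j => ?_
    · have : lam j = 0 := by simpa using hj
      rw [mul_diagonal, this, mul_zero, zero_mul]
    · rw [mul_diagonal]
      simp only [W, of_apply, transpose_apply]
      linear_combination (U x j * U y j) * Real.mul_self_sqrt (hB.eigenvalues_nonneg j)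
  refine ⟨W * E, ?_⟩
  rw [transpose_mul, Matrix.mul_assoc, ← Matrix.mul_assoc E, hE, Matrix.one_mul, hW]

variable [Fintype κ]

theorem frobenius_norm_mul_projection_le (X : Matrix κ ι ℝ) {P : Matrix ι ι ℝ} (hP : P.IsSymm)
    (hPP : IsIdempotentElem P) : ‖X * P‖ ≤ ‖X‖ := by
  classical
  have horth : trace ((X * P)ᵀ * (X * (1 - P))) = 0 := by
    rw [transpose_mul, hP, trace_mul_comm, Matrix.mul_assoc, ← Matrix.mul_assoc (1 - P),
      hPP.one_sub_mul_self, Matrix.zero_mul, Matrix.mul_zero, trace_zero]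
  have hsplit : X * P + X * (1 - P) = X := by
    rw [← Matrix.mul_add, add_sub_cancel, Matrix.mul_one]
  refine le_of_sq_le_sq ?_ (norm_nonneg X)
  calc ‖X * P‖ ^ 2 ≤ ‖X * P‖ ^ 2 + ‖X * (1 - P)‖ ^ 2 := by simp
    _ = ‖X * P + X * (1 - P)‖ ^ 2 := by rw [frobenius_norm_add_sq, horth]; ring
    _ = ‖X‖ ^ 2 := by rw [hsplit]

variable [DecidableEq ι]

theorem frobenius_norm_mul_le_of_opNorm {Z : Matrix ι ι ℝ} (Y : Matrix ι κ ℝ) :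
    ‖Z * Y‖ ≤ ‖toEuclideanCLM (𝕜 := ℝ) Z‖ * ‖Y‖ := by
  refine le_of_sq_le_sq ?_ (by positivity)
  have hcol (j : κ) : ∑ i, (Z * Y) i j ^ 2 ≤ ‖toEuclideanCLM (𝕜 := ℝ) Z‖ ^ 2 * ∑ i, Y i j ^ 2 := by
    have h := (toEuclideanCLM (𝕜 := ℝ) Z).le_opNorm (WithLp.toLp 2 fun i => Y i j)
    have h := pow_le_pow_left₀ (norm_nonneg _) h 2
    rwa [mul_pow, EuclideanSpace.real_norm_sq_eq, EuclideanSpace.real_norm_sq_eq] at h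
  rw [mul_pow, frobenius_norm_sq, frobenius_norm_sq, Finset.sum_comm,
    Finset.sum_comm (f := fun i j => Y i j ^ 2),
    Finset.mul_sum]
  exact Finset.sum_le_sum fun j _ => hcol j

theorem abs_trace_mul_le_opNorm (X Z : Matrix ι ι ℝ) :
    |trace (Xᵀ * Z)| ≤ √X.rank * ‖toEuclideanCLM (𝕜 := ℝ) Z‖ * ‖X‖ := by
  obtain ⟨P, hP, hPP, htr, hXP⟩ := exists_projection_mul_eq_self X
  have hPn : ‖P‖ = √X.rank := by
    rw [← htr, ← frobenius_norm_sq_of_isIdempotentElem hP hPP, Real.sqrt_sq (norm_nonneg P)]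
  calc |trace (Xᵀ * Z)| = |trace (Xᵀ * (Z * P))| := by
        nth_rw 1 [← hXP]
        rw [transpose_mul, hP, Matrix.mul_assoc, trace_mul_comm, Matrix.mul_assoc]
    _ ≤ ‖X‖ * ‖Z * P‖ := abs_trace_transpose_mul_le _ _
    _ ≤ ‖X‖ * (‖toEuclideanCLM (𝕜 := ℝ) Z‖ * √X.rank) := by
        rw [← hPn]; gcongr; exact frobenius_norm_mul_le_of_opNorm P
    _ = _ := by ring

theorem sq_mul_card_sub_rank_le {H M : Matrix κ ι ℝ} {k : ℕ} (hH : H.rank ≤ k) {b : ℝ}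
    (hM : (Mᵀ * M - b ^ 2 • (1 : Matrix ι ι ℝ)).PosSemidef) :
    b ^ 2 * (Fintype.card ι - k) ≤ ‖H - M‖ ^ 2 := by
  obtain ⟨P, hP, hPP, htr, hHP⟩ := exists_projection_mul_eq_self H
  have hR : (1 - P).IsSymm := isSymm_one.sub hP
  have hnorm : ‖1 - P‖ ^ 2 = Fintype.card ι - H.rank := by
    rw [frobenius_norm_sq_of_isIdempotentElem hR hPP.one_sub, trace_sub, trace_one, htr]
  have hker : (H - M) * (1 - P) = -(M * (1 - P)) := by
    rw [Matrix.sub_mul, Matrix.mul_sub H, hHP, Matrix.mul_one, sub_self, zero_sub]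
  have hgrow : b ^ 2 * ‖1 - P‖ ^ 2 ≤ ‖M * (1 - P)‖ ^ 2 := by
    have h := (hM.conjTranspose_mul_mul_same (1 - P)).trace_nonneg
    have heq : (1 - P)ᵀ * (Mᵀ * M - b ^ 2 • 1) * (1 - P) =
        (M * (1 - P))ᵀ * (M * (1 - P)) - b ^ 2 • ((1 - P)ᵀ * (1 - P)) := by
      generalize 1 - P = R
      simp only [transpose_mul, Matrix.mul_sub, Matrix.sub_mul, Matrix.mul_assoc, Matrix.mul_smul,
        Matrix.smul_mul, Matrix.one_mul]
    rw [conjTranspose_eq_transpose_of_trivial, heq, trace_sub, trace_smul, smul_eq_mul,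
      ← frobenius_norm_sq_eq_trace, ← frobenius_norm_sq_eq_trace] at h
    exact sub_nonneg.1 h
  calc b ^ 2 * (Fintype.card ι - k) ≤ b ^ 2 * (Fintype.card ι - H.rank) := by gcongr
    _ ≤ ‖M * (1 - P)‖ ^ 2 := by rw [← hnorm]; exact hgrow
    _ = ‖(H - M) * (1 - P)‖ ^ 2 := by rw [hker, norm_neg]
    _ ≤ ‖H - M‖ ^ 2 := by
        gcongr; exact frobenius_norm_mul_projection_le _ hR hPP.one_sub

theorem two_mul_trace_mul_one_sub_le {H B P : Matrix ι ι ℝ} {k : ℕ} (hH : H.rank ≤ k)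
    (hP : P.IsSymm) (hPP : IsIdempotentElem P) (htr : trace P = k) (hPB : P * B = B) {b : ℝ}
    (hb : (Bᵀ * B - b ^ 2 • P).PosSemidef) :
    2 * b * trace (Hᵀ * (1 - P)) ≤ ‖H - B‖ ^ 2 := by
  have hR : (1 - P)ᵀ = 1 - P := isSymm_one.sub hP
  have hRB : (1 - P) * B = 0 := by rw [Matrix.sub_mul, hPB, Matrix.one_mul, sub_self]
  have hBR : Bᵀ * (1 - P) = 0 := by rw [← hR, ← transpose_mul, hRB, transpose_zero]
  have hM : (B + b • (1 - P))ᵀ * (B + b • (1 - P)) - b ^ 2 • 1 = Bᵀ * B - b ^ 2 • P := by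
    rw [transpose_add, transpose_smul, hR, Matrix.add_mul, Matrix.mul_add, Matrix.mul_add,
      Matrix.mul_smul, hBR, Matrix.smul_mul, hRB, Matrix.smul_mul, Matrix.mul_smul,
      hPP.one_sub, smul_smul, ← sq, smul_sub]
    simp only [smul_zero, add_zero, zero_add]
    abel
  have hnorm : ‖1 - P‖ ^ 2 = Fintype.card ι - k := by
    rw [frobenius_norm_sq_of_isIdempotentElem hR hPP.one_sub, trace_sub, trace_one, htr]
  have hexp : ‖H - (B + b • (1 - P))‖ ^ 2 =
      ‖H - B‖ ^ 2 - 2 * b * trace (Hᵀ * (1 - P)) + b ^ 2 * (Fintype.card ι - k) := by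
    rw [← sub_sub, frobenius_norm_sub_sq, norm_smul, mul_pow, hnorm, Matrix.mul_smul, trace_smul,
      transpose_sub, Matrix.sub_mul, hBR, sub_zero, Real.norm_eq_abs, sq_abs, smul_eq_mul]
    ring
  have hlow := sq_mul_card_sub_rank_le hH (hM ▸ hb)
  linarith

theorem norm_sub_le_of_best_approx {H A B Q Z P : Matrix ι ι ℝ} {k : ℕ} (hH : H.rank ≤ k)
    (hP : P.IsSymm) (hPP : IsIdempotentElem P) (htr : trace P = k) (hPB : P * B = B)
    {a b τ : ℝ} (hb0 : 0 ≤ b) (hb : (Bᵀ * B - b ^ 2 • P).PosSemidef) (hBQ : trace (Bᵀ * Q) = 0)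
    (ha : 0 ≤ a) (hHQ : trace (Hᵀ * Q) ≤ a * trace (Hᵀ * (1 - P)))
    (hZ : ‖toEuclideanCLM (𝕜 := ℝ) Z‖ ≤ τ) (hA : A = B + Q + Z) (hopt : ‖H - A‖ ≤ ‖B - A‖) :
    (b - a) * ‖H - B‖ ≤ 2 * b * (√(2 * k) * τ) := by
  have hgrow := two_mul_trace_mul_one_sub_le hH hP hPP htr hPB hb
  have hrankB : B.rank ≤ k := by
    rw [← hPB, ← Nat.cast_le (α := ℝ), ← htr, ← rank_eq_trace_of_isIdempotentElem hPP]
    exact_mod_cast rank_mul_le_left P B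
  have hnoise : trace ((H - B)ᵀ * Z) ≤ √(2 * k) * τ * ‖H - B‖ := by
    refine (le_abs_self _).trans ((abs_trace_mul_le_opNorm _ Z).trans ?_)
    have hrank : ((H - B).rank : ℝ) ≤ 2 * k := by
      exact_mod_cast (rank_sub_le H B).trans (by lia)
    gcongr
  have hcross : ‖H - B‖ ^ 2 ≤ 2 * (trace (Hᵀ * Q) + trace ((H - B)ᵀ * Z)) := by
    have hsq : ‖H - A‖ ^ 2 ≤ ‖B - A‖ ^ 2 := pow_le_pow_left₀ (norm_nonneg _) hopt 2
    rw [show H - A = (H - B) - (Q + Z) by rw [hA]; abel,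
      show B - A = -(Q + Z) by rw [hA]; abel, norm_neg, frobenius_norm_sub_sq, Matrix.mul_add,
      trace_add, transpose_sub, Matrix.sub_mul, trace_sub, hBQ] at hsq
    rw [transpose_sub]
    linarith
  rcases (norm_nonneg (H - B)).eq_or_lt with h0 | h0
  · rw [← h0, mul_zero]
    have : 0 ≤ τ := (norm_nonneg _).trans hZ
    positivity
  · refine le_of_mul_le_mul_right ?_ h0
    nlinarith

end Rank

section Ridge

open scoped Matrix.Norms.Frobenius

variable {ι κ μ : Type*} [Fintype ι] [Fintype κ] [Fintype μ]

theorem smul_eq_transpose_mul_of_ridge {X : Matrix ι κ ℝ} {Y : Matrix ι μ ℝ} {σ : ℝ}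
    {b : Matrix κ μ ℝ}
    (hb : ∀ b' : Matrix κ μ ℝ, ‖X * b - Y‖ ^ 2 + σ * ‖b‖ ^ 2 ≤ ‖X * b' - Y‖ ^ 2 + σ * ‖b'‖ ^ 2) :
    σ • b = Xᵀ * (Y - X * b) := by
  set D := Xᵀ * (Y - X * b) - σ • b with hD
  have hgrad : trace ((X * b - Y)ᵀ * (X * D)) + σ * trace (bᵀ * D) = -‖D‖ ^ 2 := by
    have hDt : (X * b - Y)ᵀ * X + σ • bᵀ = -Dᵀ := by
      simp only [hD, transpose_sub, transpose_mul, transpose_smul, transpose_transpose,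
        Matrix.sub_mul]
      abel
    rw [← smul_eq_mul, ← trace_smul, ← trace_add, ← Matrix.mul_assoc, ← Matrix.smul_mul,
      ← Matrix.add_mul, hDt, Matrix.neg_mul, trace_neg, frobenius_norm_sq_eq_trace]
  have hline (t : ℝ) :
      0 ≤ (‖X * D‖ ^ 2 + σ * ‖D‖ ^ 2) * (t * t) + -(2 * ‖D‖ ^ 2) * t + 0 := by
    have h := hb (b + t • D)
    rw [show X * (b + t • D) - Y = X * b - Y + t • (X * D) by
        rw [Matrix.mul_add, Matrix.mul_smul]; abel,
      frobenius_norm_add_sq, frobenius_norm_add_sq, norm_smul, norm_smul, mul_pow, mul_pow,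
      Real.norm_eq_abs, sq_abs, Matrix.mul_smul, Matrix.mul_smul, trace_smul, trace_smul,
      smul_eq_mul, smul_eq_mul] at h
    linear_combination h + 2 * t * hgrad
  have hdiscrim := discrim_le_zero hline
  rw [discrim] at hdiscrim
  have hD0 : ‖D‖ ^ 2 = 0 := by nlinarith [sq_nonneg (‖D‖ ^ 2)]
  exact (sub_eq_zero.1 (norm_eq_zero.1 (pow_eq_zero_iff two_ne_zero |>.1 hD0))).symm

theorem norm_le_of_smul_eq_neg_gram_mul {F : Matrix ι κ ℝ} {P : Matrix ι ι ℝ} {u W : Matrix ι μ ℝ}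
    {σ : ℝ} (hP : P.IsSymm) (hPu : P * u = u) (h : σ • u = -(P * (F * Fᵀ * u + W))) :
    σ * ‖u‖ ≤ ‖W‖ := by
  have hgram : 0 ≤ trace (uᵀ * (F * Fᵀ * u)) := by
    rw [Matrix.mul_assoc F, ← Matrix.mul_assoc uᵀ, ← transpose_transpose F, ← transpose_mul,
      transpose_transpose, ← frobenius_norm_sq_eq_trace]
    positivity
  have henergy : σ * ‖u‖ ^ 2 = -trace (uᵀ * (F * Fᵀ * u)) - trace (uᵀ * W) := by
    have huP : uᵀ * P = uᵀ := by conv_rhs => rw [← hPu, transpose_mul, hP]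
    rw [frobenius_norm_sq_eq_trace, ← smul_eq_mul, ← trace_smul, ← Matrix.mul_smul, h,
      Matrix.mul_neg, ← Matrix.mul_assoc, huP, Matrix.mul_add, trace_neg, trace_add]
    ring
  have hcs := (abs_le.1 (abs_trace_transpose_mul_le u W)).1
  rcases (norm_nonneg u).eq_or_lt with h0 | h0
  · rw [← h0, mul_zero]
    exact norm_nonneg W
  · exact le_of_mul_le_mul_right (by linarith) h0

theorem exists_dual_weights_of_ridge {F : Matrix ι κ ℝ} {P : Matrix ι ι ℝ} {Y : Matrix ι μ ℝ}
    {b : Matrix κ μ ℝ} {σ : ℝ} (hσ : σ ≠ 0) (hP : P.IsSymm) (hPP : IsIdempotentElem P)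
    (hb : ∀ b' : Matrix κ μ ℝ, ‖P * (F * b - Y)‖ ^ 2 + σ * ‖b‖ ^ 2 ≤
      ‖P * (F * b' - Y)‖ ^ 2 + σ * ‖b'‖ ^ 2) :
    ∃ w : Matrix ι μ ℝ, P * w = w ∧ b = Fᵀ * w ∧ σ • w = P * (Y - F * Fᵀ * w) := by
  have hPb : b = Fᵀ * σ⁻¹ • (P * (Y - F * b)) := by
    have h := smul_eq_transpose_mul_of_ridge (X := P * F) (Y := P * Y) (b := b) (σ := σ)
      fun b' => by simpa only [Matrix.mul_sub, Matrix.mul_assoc] using hb b'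
    rw [transpose_mul, hP, Matrix.mul_assoc P F, ← Matrix.mul_sub, Matrix.mul_assoc,
      ← Matrix.mul_assoc P P, hPP] at h
    rw [Matrix.mul_smul, ← h, smul_smul, inv_mul_cancel₀ hσ, one_smul]
  refine ⟨σ⁻¹ • (P * (Y - F * b)), ?_, hPb, ?_⟩
  · rw [Matrix.mul_smul, ← Matrix.mul_assoc, hPP]
  · rw [Matrix.mul_assoc F, ← hPb, smul_smul, mul_inv_cancel₀ hσ, one_smul]

/- For `u = w - (θ + σ)⁻¹ • P Y` the equation for the dual weights `w` becomes
`σ u = -P (F Fᵀ u + (θ + σ)⁻¹ (F Fᵀ - K) P Y)`. -/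
theorem norm_gram_mul_sub_smul_le {F : Matrix ι κ ℝ} {K P : Matrix ι ι ℝ} {Y w : Matrix ι μ ℝ}
    {σ θ : ℝ} (hσ : 0 < σ) (hθ : 0 ≤ θ) (hP : P.IsSymm) (hPP : IsIdempotentElem P)
    (hK : K * (P * Y) = θ • Y) (hPw : P * w = w) (hw : σ • w = P * (Y - F * Fᵀ * w)) :
    ‖F * Fᵀ * w - (θ / (θ + σ)) • Y‖ ≤ ‖F * Fᵀ - K‖ * ‖P * Y‖ / σ * (1 + ‖F * Fᵀ‖ / σ) := by
  set t := (θ + σ)⁻¹ with ht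
  have ht0 : 0 ≤ t := by positivity
  set W := (F * Fᵀ - K) * (P * Y) with hW
  set u := w - t • (P * Y) with hu
  have hsplit : F * Fᵀ * w - (θ / (θ + σ)) • Y = F * Fᵀ * u + t • W := by
    rw [div_eq_mul_inv, mul_comm θ, ← smul_smul, ← hK, hu, hW, Matrix.mul_sub, Matrix.sub_mul,
      Matrix.mul_smul, smul_sub]
    abel
  have hPu : P * u = u := by
    rw [hu, Matrix.mul_sub, Matrix.mul_smul, ← Matrix.mul_assoc P P, hPP, hPw]
  have hnormal : σ • u = -(P * (F * Fᵀ * u + t • W)) := by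
    have hσt : σ * t = 1 - θ / (θ + σ) := by rw [ht]; field_simp; ring
    rw [← hsplit, hu, smul_sub, hw, smul_smul, hσt, Matrix.mul_sub, Matrix.mul_sub,
      Matrix.mul_smul, sub_smul, one_smul]
    abel
  have hu_le : ‖u‖ ≤ t * ‖W‖ / σ := by
    rw [le_div_iff₀ hσ, mul_comm, ← Real.norm_of_nonneg ht0, ← norm_smul]
    exact norm_le_of_smul_eq_neg_gram_mul hP hPu hnormal
  calc ‖F * Fᵀ * w - (θ / (θ + σ)) • Y‖ ≤ ‖F * Fᵀ‖ * ‖u‖ + t * ‖W‖ := by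
        rw [hsplit]
        refine (norm_add_le _ _).trans (add_le_add (frobenius_norm_mul _ _) ?_)
        rw [norm_smul, Real.norm_of_nonneg ht0]
    _ ≤ ‖F * Fᵀ‖ * (t * ‖W‖ / σ) + t * ‖W‖ := by gcongr
    _ = t * ‖W‖ * (1 + ‖F * Fᵀ‖ / σ) := by ring
    _ ≤ σ⁻¹ * (‖F * Fᵀ - K‖ * ‖P * Y‖) * (1 + ‖F * Fᵀ‖ / σ) := by
        gcongr
        · exact inv_anti₀ hσ (by linarith)
        · exact frobenius_norm_mul _ _
    _ = ‖F * Fᵀ - K‖ * ‖P * Y‖ / σ * (1 + ‖F * Fᵀ‖ / σ) := by ring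

theorem norm_ridge_sub_smul_le {F : Matrix ι κ ℝ} {K P : Matrix ι ι ℝ} {Y : Matrix ι μ ℝ}
    {b : Matrix κ μ ℝ} {σ θ : ℝ} (hσ : 0 < σ) (hθ : 0 ≤ θ) (hP : P.IsSymm)
    (hPP : IsIdempotentElem P) (hK : K * (P * Y) = θ • Y)
    (hb : ∀ b' : Matrix κ μ ℝ, ‖P * (F * b - Y)‖ ^ 2 + σ * ‖b‖ ^ 2 ≤
      ‖P * (F * b' - Y)‖ ^ 2 + σ * ‖b'‖ ^ 2) :
    ‖F * b - (θ / (θ + σ)) • Y‖ ≤ ‖F * Fᵀ - K‖ * ‖P * Y‖ / σ * (1 + ‖F * Fᵀ‖ / σ) := by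
  obtain ⟨w, hPw, rfl, hw⟩ := exists_dual_weights_of_ridge hσ.ne' hP hPP hb
  rw [← Matrix.mul_assoc]
  exact norm_gram_mul_sub_smul_le hσ hθ hP hPP hK hPw hw

theorem ridge_bound_le {q r n η δ τ Δ G : ℝ} (hq : 1 ≤ q) (hr : 1 ≤ r) (hn : 0 < n) (hη : 0 < η)
    (hη1 : η ≤ 1) (hδ : 0 < δ) (hΔ0 : 0 ≤ Δ) (hΔ : Δ ≤ 8 * q * √q * τ / δ)
    (hG : G ≤ 5 * q * √q * n) :
    Δ * √(r * n) / (η * (r * n)) * (1 + G / (η * (r * n))) ≤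
      48 * q ^ 3 * τ / (η ^ 2 * δ * √n) := by
  have hfactor : 1 + G / (η * (r * n)) ≤ 6 * q * √q / η := by
    have hone : 1 ≤ q * √q / η := by
      rw [one_le_div hη]
      exact hη1.trans (one_le_mul_of_one_le_of_one_le hq (Real.one_le_sqrt.2 hq))
    calc 1 + G / (η * (r * n)) ≤ q * √q / η + 5 * q * √q * n / (η * (1 * n)) := by gcongr
      _ = 6 * q * √q / η := by field_simp; ring
  have hscale : √(r * n) / (η * (r * n)) ≤ 1 / (η * √n) := by
    have hsqrt : √(r * n) * √n ≤ r * n := by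
      rw [← Real.sqrt_mul (by positivity)]
      exact Real.sqrt_le_iff.2 ⟨by positivity, by nlinarith [sq_nonneg n]⟩
    rw [div_le_div_iff₀ (by positivity) (by positivity)]
    nlinarith
  have hqq : √q * √q = q := Real.mul_self_sqrt (by linarith)
  calc Δ * √(r * n) / (η * (r * n)) * (1 + G / (η * (r * n)))
      ≤ Δ * √(r * n) / (η * (r * n)) * (6 * q * √q / η) := by gcongr
    _ ≤ 8 * q * √q * τ / δ * (1 / (η * √n)) * (6 * q * √q / η) := by
        have hΔ1 : 0 ≤ 8 * q * √q * τ / δ := hΔ0.trans hΔ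
        rw [mul_div_assoc]
        gcongr
    _ = 48 * (√q * √q) * q ^ 2 * τ / (η ^ 2 * δ * √n) := by field_simp; ring
    _ = 48 * q ^ 3 * τ / (η ^ 2 * δ * √n) := by rw [hqq]; ring

end Ridge

section TraceBounds

open scoped Matrix.Norms.Frobenius

variable {ι κ : Type*} [Fintype ι] [Fintype κ]

theorem abs_sum_sum_le_opNorm [DecidableEq ι] (Z : Matrix ι ι ℝ) :
    |∑ i, ∑ j, Z i j| ≤ ‖toEuclideanCLM (𝕜 := ℝ) Z‖ * Fintype.card ι := by
  set J : Matrix ι Unit ℝ := of fun _ _ => 1 with hJ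
  have hJn : ‖J‖ ^ 2 = Fintype.card ι := by simp [hJ, frobenius_norm_sq]
  have hsum : ∑ i, ∑ j, Z i j = trace (Jᵀ * (Z * J)) := by simp [hJ, trace, mul_apply]
  calc |∑ i, ∑ j, Z i j| ≤ ‖J‖ * ‖Z * J‖ := hsum ▸ abs_trace_transpose_mul_le _ _
    _ ≤ ‖J‖ * (‖toEuclideanCLM (𝕜 := ℝ) Z‖ * ‖J‖) := by
        gcongr
        exact frobenius_norm_mul_le_of_opNorm J
    _ = ‖toEuclideanCLM (𝕜 := ℝ) Z‖ * Fintype.card ι := by rw [← hJn]; ring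

theorem trace_mul_transpose_mul_nonneg (F : Matrix ι κ ℝ) {X : Matrix ι ι ℝ} (hX : X.PosSemidef) :
    0 ≤ trace (F * Fᵀ * X) := by
  rw [Matrix.mul_assoc, trace_mul_comm]
  exact (hX.conjTranspose_mul_mul_same F).trace_nonneg

end TraceBounds

section Averaging

/-- The matrix that replaces each coordinate of a vector by the average of all coordinates. -/
noncomputable def avgMat (ι : Type*) [Fintype ι] : Matrix ι ι ℝ :=
  of fun _ _ => (Fintype.card ι : ℝ)⁻¹

variable {ι : Type*} [Fintype ι]

theorem isSymm_avgMat : (avgMat ι).IsSymm := rfl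

theorem avgMat_mulVec (v : ι → ℝ) : avgMat ι *ᵥ v = fun _ => (Fintype.card ι : ℝ)⁻¹ * ∑ i, v i := by
  ext
  simp only [mulVec, dotProduct, avgMat, of_apply, Finset.mul_sum]

variable [Nonempty ι]

theorem isIdempotentElem_avgMat : IsIdempotentElem (avgMat ι) := by
  ext i j
  simp [avgMat, mul_apply]

theorem trace_avgMat : trace (avgMat ι) = 1 := by
  simp [trace, avgMat]

theorem avgMat_mulVec_const (c : ℝ) : avgMat ι *ᵥ (fun _ => c) = fun _ => c := by
  simp [avgMat_mulVec]

end Averaging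

section Rescaling

theorem norm_sub_inv_smul_le {E : Type*} [NormedAddCommGroup E] [NormedSpace ℝ E] {G B : E}
    {t u ε : ℝ} (hu : 0 < u) (hε : ε ≤ 1 / 2) (ht : |t - u| ≤ ε * u) :
    ‖G - u⁻¹ • B‖ ≤ 2 * u⁻¹ * (‖t • G - B‖ + ε * ‖B‖) := by
  have hut : u / 2 ≤ t := by nlinarith [(abs_le.1 ht).1]
  have hcoeff : |1 - t * u⁻¹| ≤ ε := by
    rw [show 1 - t * u⁻¹ = (u - t) / u by field_simp, abs_div, abs_sub_comm, abs_of_pos hu]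
    exact (div_le_iff₀ hu).2 ht
  have hdecomp : t • (G - u⁻¹ • B) = (t • G - B) + (1 - t * u⁻¹) • B := by module
  have key : u / 2 * ‖G - u⁻¹ • B‖ ≤ ‖t • G - B‖ + ε * ‖B‖ := by
    calc u / 2 * ‖G - u⁻¹ • B‖ ≤ t * ‖G - u⁻¹ • B‖ := by gcongr
      _ = ‖t • (G - u⁻¹ • B)‖ := by rw [norm_smul, Real.norm_of_nonneg (by linarith)]
      _ ≤ ‖t • G - B‖ + ‖(1 - t * u⁻¹) • B‖ := hdecomp ▸ norm_add_le _ _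
      _ ≤ ‖t • G - B‖ + ε * ‖B‖ := by rw [norm_smul, Real.norm_eq_abs]; gcongr
  calc ‖G - u⁻¹ • B‖ = 2 * u⁻¹ * (u / 2 * ‖G - u⁻¹ • B‖) := by field_simp
    _ ≤ 2 * u⁻¹ * (‖t • G - B‖ + ε * ‖B‖) := by gcongr

end Rescaling

section Concentration

open MeasureTheory ProbabilityTheory SBM

/-- A Bernoulli variable with success probability `p`, minus its mean. -/
noncomputable def centered (p : ℝ) (b : Bool) : ℝ := (if b then 1 else 0) - p

theorem isProbabilityMeasure_bernoulliLaw {p : ℝ} (hp : p ∈ Set.Icc 0 1) :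
    IsProbabilityMeasure (bernoulliLaw p) := by
  constructor
  simp only [bernoulliLaw, Measure.add_apply, Measure.smul_apply, measure_univ, smul_eq_mul,
    mul_one]
  rw [← ENNReal.ofReal_add hp.1 (sub_nonneg.2 hp.2), add_sub_cancel, ENNReal.ofReal_one]

theorem hasSubgaussianMGF_centered {p : ℝ} (hp : p ∈ Set.Icc 0 1) :
    HasSubgaussianMGF (centered p) (1 / 4) (bernoulliLaw p) := by
  have := isProbabilityMeasure_bernoulliLaw hp
  have hmean : ∫ b, (if b then (1 : ℝ) else 0) ∂(bernoulliLaw p) = p := by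
    rw [integral_fintype (Integrable.of_finite)]
    simp [Measure.real, bernoulliLaw, hp.1]
  have hsub := hasSubgaussianMGF_of_mem_Icc (μ := bernoulliLaw p)
    (X := fun b : Bool => if b then (1 : ℝ) else 0) (a := 0) (b := 1)
    (Measurable.of_discrete).aemeasurable
    (Filter.Eventually.of_forall fun b => by cases b <;> simp)
  rw [hmean, sub_zero, nnnorm_one] at hsub
  have hquarter : (1 / 4 : NNReal) = (1 / 2) ^ 2 := by norm_num
  rwa [hquarter]

variable {ι : Type*} [Fintype ι]

theorem measure_sum_mul_centered_ge_le {p : ι → ℝ} (hp : ∀ i, p i ∈ Set.Icc 0 1) {c : ι → ℝ}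
    {V : NNReal} (hc : ∑ i, c i ^ 2 ≤ V) {s : ℝ} (hs : 0 ≤ s) :
    (Measure.pi fun i => bernoulliLaw (p i)).real {g | s ≤ ∑ i, c i * centered (p i) (g i)} ≤
      Real.exp (-(2 * s ^ 2 / V)) := by
  have (i : ι) := isProbabilityMeasure_bernoulliLaw (hp i)
  have hindep := iIndepFun_pi (μ := fun i => bernoulliLaw (p i))
    (X := fun i b => c i * centered (p i) b) fun i => (Measurable.of_discrete).aemeasurable
  have hsub (i : ι) : HasSubgaussianMGF (fun g : ι → Bool => c i * centered (p i) (g i))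
      (Real.toNNReal (c i ^ 2) * (1 / 4)) (Measure.pi fun i => bernoulliLaw (p i)) := by
    have h := (hasSubgaussianMGF_centered (hp i)).const_mul (c i)
    rw [← (measurePreserving_eval (fun i => bernoulliLaw (p i)) i).map_eq] at h
    rw [Real.toNNReal_of_nonneg (sq_nonneg _)]
    exact HasSubgaussianMGF.of_map (X := fun b => c i * centered (p i) b)
      (measurable_pi_apply i).aemeasurable h
  have hsum := HasSubgaussianMGF.sum_of_iIndepFun hindep (s := Finset.univ) fun i _ => hsub i
  have hsum' : HasSubgaussianMGF (fun g : ι → Bool => ∑ i, c i * centered (p i) (g i)) (V * (1 / 4))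
      (Measure.pi fun i => bernoulliLaw (p i)) := by
    refine ⟨hsum.integrable_exp_mul, fun t => (hsum.mgf_le t).trans ?_⟩
    refine Real.exp_le_exp.2 ?_
    gcongr
    rw [← Finset.sum_mul, ← NNReal.coe_le_coe]
    push_cast
    simp only [Real.coe_toNNReal _ (sq_nonneg _)]
    gcongr
  refine (hsum'.measure_ge_le hs).trans_eq ?_
  push_cast
  congr 1
  field_simp
  norm_num

variable [DecidableEq ι]

/-- The centered adjacency matrix of the graph `g` on `ι` with edge probabilities `p`. -/
noncomputable def noise (p : Sym2 ι → ℝ) (g : Sym2 ι → Bool) : Matrix ι ι ℝ :=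
  Matrix.of fun x y => centered (p s(x, y)) (g s(x, y))

theorem card_filter_mk_eq_le_two (e : Sym2 ι) :
    (Finset.univ.filter fun q : ι × ι => s(q.1, q.2) = e).card ≤ 2 := by
  induction e with
  | h a b =>
    refine (Finset.card_le_card (t := {(a, b), (b, a)}) fun q hq => ?_).trans Finset.card_le_two
    simpa [Prod.ext_iff] using hq

/-- The coefficient of the edge variable `e` in the bilinear form `u ⬝ᵥ noise p g *ᵥ v`. -/
def edgeCoeff (u v : ι → ℝ) (e : Sym2 ι) : ℝ :=
  ∑ q : ι × ι with s(q.1, q.2) = e, u q.1 * v q.2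

theorem dotProduct_noise_mulVec (p : Sym2 ι → ℝ) (g : Sym2 ι → Bool) (u v : ι → ℝ) :
    u ⬝ᵥ noise p g *ᵥ v = ∑ e, edgeCoeff u v e * centered (p e) (g e) := by
  calc u ⬝ᵥ noise p g *ᵥ v
      = ∑ q : ι × ι, u q.1 * v q.2 * centered (p s(q.1, q.2)) (g s(q.1, q.2)) := by
        simp only [dotProduct, mulVec, noise, of_apply, Finset.mul_sum, Fintype.sum_prod_type]
        exact Finset.sum_congr rfl fun _ _ => Finset.sum_congr rfl fun _ _ => by ring
    _ = ∑ e, edgeCoeff u v e * centered (p e) (g e) := by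
        rw [← Finset.sum_fiberwise Finset.univ (fun q : ι × ι => s(q.1, q.2))]
        refine Finset.sum_congr rfl fun e _ => ?_
        rw [edgeCoeff, Finset.sum_mul]
        exact Finset.sum_congr rfl fun q hq => by rw [(Finset.mem_filter.1 hq).2]

theorem sum_sq_edgeCoeff_le (u v : ι → ℝ) :
    ∑ e, edgeCoeff u v e ^ 2 ≤ 2 * ((∑ i, u i ^ 2) * ∑ i, v i ^ 2) := by
  calc ∑ e, edgeCoeff u v e ^ 2
      ≤ ∑ e, 2 * ∑ q : ι × ι with s(q.1, q.2) = e, (u q.1 * v q.2) ^ 2 := by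
        refine Finset.sum_le_sum fun e _ => sq_sum_le_card_mul_sum_sq.trans ?_
        gcongr
        exact_mod_cast card_filter_mk_eq_le_two e
    _ = 2 * ∑ q : ι × ι, (u q.1 * v q.2) ^ 2 := by rw [← Finset.mul_sum, Finset.sum_fiberwise]
    _ = 2 * ((∑ i, u i ^ 2) * ∑ i, v i ^ 2) := by
        simp only [Fintype.sum_prod_type, Finset.sum_mul_sum, mul_pow]

theorem measure_inner_noise_ge_le {p : Sym2 ι → ℝ} (hp : ∀ e, p e ∈ Set.Icc 0 1)
    {x y : EuclideanSpace ℝ ι} (hx : ‖x‖ ≤ 1) (hy : ‖y‖ ≤ 1) {s : ℝ} (hs : 0 ≤ s) :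
    (Measure.pi fun e => bernoulliLaw (p e)).real
      {g | s ≤ inner ℝ y (toEuclideanCLM (𝕜 := ℝ) (noise p g) x)} ≤ Real.exp (-s ^ 2) := by
  have hform (g : Sym2 ι → Bool) : inner ℝ y (toEuclideanCLM (𝕜 := ℝ) (noise p g) x) =
      ∑ e, edgeCoeff y x e * centered (p e) (g e) := by
    rw [← dotProduct_noise_mulVec, EuclideanSpace.inner_eq_star_dotProduct, dotProduct_comm]
    simp
  have hV : ∑ e, edgeCoeff y x e ^ 2 ≤ (2 : NNReal) := by
    refine (sum_sq_edgeCoeff_le _ _).trans ?_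
    rw [← EuclideanSpace.real_norm_sq_eq, ← EuclideanSpace.real_norm_sq_eq]
    have hyx : ‖y‖ ^ 2 * ‖x‖ ^ 2 ≤ 1 := by
      rw [← mul_pow]; exact pow_le_one₀ (by positivity) (mul_le_one₀ hy (norm_nonneg _) hx)
    push_cast
    linarith
  simp only [hform]
  refine (measure_sum_mul_centered_ge_le hp hV hs).trans_eq ?_
  push_cast
  congr 1
  field_simp

end Concentration

section Net

open Metric

theorem packingNumber_half_closedBall_le (E : Type*) [NormedAddCommGroup E] [NormedSpace ℝ E]
    [FiniteDimensional ℝ E] :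
    packingNumber (1 / 2) (closedBall (0 : E) 1) ≤ 5 ^ Module.finrank ℝ E := by
  classical
  have hfin (t : Finset E) (ht : (t : Set E) ⊆ closedBall 0 1)
      (hsep : IsSeparated (1 / 2 : NNReal) (t : Set E)) : t.card ≤ 5 ^ Module.finrank ℝ E := by
    rw [← Finset.card_image_of_injective t (smul_right_injective E (two_ne_zero (α := ℝ)))]
    refine Besicovitch.card_le_of_separated _ (Finset.forall_mem_image.2 fun x hx => ?_)
      (Finset.forall_mem_image.2 fun x hx => Finset.forall_mem_image.2 fun y hy hxy => ?_)
    · rw [norm_smul, Real.norm_two]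
      linarith [mem_closedBall_zero_iff.1 (ht hx)]
    · have hdist : (1 / 2 : ℝ) < dist x y := by
        have h : ((1 / 2 : NNReal) : ENNReal) < edist x y := hsep hx hy (ne_of_apply_ne _ hxy)
        rw [edist_nndist, ENNReal.coe_lt_coe] at h
        exact_mod_cast h
      rw [← smul_sub, norm_smul, Real.norm_two, ← dist_eq_norm]
      linarith
  refine iSup_le fun C => iSup_le fun hC => iSup_le fun hsep => ?_
  by_contra! h
  obtain ⟨t, htC, ht⟩ := Set.exists_subset_encard_eq (Order.add_one_le_of_lt h)
  have htfin : t.Finite := Set.finite_of_encard_eq_coe (k := 5 ^ Module.finrank ℝ E + 1)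
    (by rw [ht]; push_cast; rfl)
  lift t to Finset E using htfin
  have hcard := hfin t (htC.trans hC) (hsep.subset htC)
  rw [Set.encard_coe_eq_coe_finsetCard] at ht
  have : t.card = 5 ^ Module.finrank ℝ E + 1 := by exact_mod_cast ht
  omega

theorem exists_isCover_closedBall_card_le (E : Type*) [NormedAddCommGroup E] [NormedSpace ℝ E]
    [FiniteDimensional ℝ E] :
    ∃ s : Finset E, (∀ x ∈ s, ‖x‖ ≤ 1) ∧ IsCover (1 / 2) (closedBall 0 1) (s : Set E) ∧
      s.card ≤ 5 ^ Module.finrank ℝ E := by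
  have hpack := packingNumber_half_closedBall_le E
  have htop : packingNumber (1 / 2) (closedBall (0 : E) 1) ≠ ⊤ :=
    ne_top_of_le_ne_top (by exact_mod_cast ENat.natCast_ne_top (5 ^ Module.finrank ℝ E)) hpack
  have hcard := encard_maximalSeparatedSet htop
  have hfin := Set.encard_ne_top_iff.1 (hcard ▸ htop)
  refine ⟨hfin.toFinset, fun x hx => ?_, ?_, ?_⟩
  · exact mem_closedBall_zero_iff.1 (maximalSeparatedSet_subset (hfin.mem_toFinset.1 hx))
  · rw [hfin.coe_toFinset]
    exact isCover_maximalSeparatedSet htop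
  · rw [← hcard, hfin.encard_eq_coe_toFinset_card] at hpack
    exact_mod_cast hpack

theorem opNorm_le_of_isCover {E : Type*} [NormedAddCommGroup E] [InnerProductSpace ℝ E]
    {s : Set E} (hs : IsCover (1 / 2) (closedBall 0 1) s) (T : E →L[ℝ] E) {M : ℝ}
    (hM : 0 ≤ M) (h : ∀ x ∈ s, ∀ y ∈ s, inner ℝ y (T x) ≤ M) : ‖T‖ ≤ 4 * M := by
  have hclose (x : E) (hx : ‖x‖ ≤ 1) : ∃ y ∈ s, ‖x - y‖ ≤ 1 / 2 := by
    obtain ⟨y, hy, (hxy : edist x y ≤ (1 / 2 : NNReal))⟩ := hs (mem_closedBall_zero_iff.2 hx)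
    refine ⟨y, hy, ?_⟩
    rw [edist_nndist, ENNReal.coe_le_coe] at hxy
    rw [← dist_eq_norm]
    exact_mod_cast hxy
  have hnet (x : E) (hx : x ∈ s) : ‖T x‖ ≤ 2 * M := by
    rcases eq_or_ne (T x) 0 with h0 | h0
    · rw [h0, norm_zero]; positivity
    obtain ⟨y, hy, hyx⟩ := hclose (‖T x‖⁻¹ • T x) (norm_smul_inv_norm (𝕜 := ℝ) h0).le
    have hself : inner ℝ (‖T x‖⁻¹ • T x) (T x) = ‖T x‖ := by
      rw [real_inner_smul_left, real_inner_self_eq_norm_sq]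
      field_simp
    have hsub : inner ℝ (‖T x‖⁻¹ • T x - y) (T x) ≤ 1 / 2 * ‖T x‖ :=
      (real_inner_le_norm _ _).trans (by gcongr)
    rw [inner_sub_left, hself] at hsub
    linarith [h x hx y hy]
  have hball : ‖T‖ ≤ 2 * M + ‖T‖ * (1 / 2) := by
    refine T.opNorm_le_of_unit_norm (by positivity) fun x hx => ?_
    obtain ⟨y, hy, hxy⟩ := hclose x hx.le
    calc ‖T x‖ = ‖T y + T (x - y)‖ := by rw [← map_add, add_sub_cancel]
      _ ≤ ‖T y‖ + ‖T (x - y)‖ := norm_add_le _ _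
      _ ≤ 2 * M + ‖T‖ * (1 / 2) := add_le_add (hnet y hy) ((T.le_opNorm _).trans (by gcongr))
  linarith

end Net

section NoiseNorm

open MeasureTheory SBM Metric

variable {ι : Type*} [Fintype ι] [DecidableEq ι]

theorem measure_exists_inner_noise_ge_le {p : Sym2 ι → ℝ} (hp : ∀ e, p e ∈ Set.Icc 0 1)
    {s : Finset (EuclideanSpace ℝ ι)} (hs : ∀ x ∈ s, ‖x‖ ≤ 1) {M : ℝ} (hM : 0 ≤ M) :
    (Measure.pi fun e => bernoulliLaw (p e)).real
      {g | ∃ x ∈ s, ∃ y ∈ s, M ≤ inner ℝ y (toEuclideanCLM (𝕜 := ℝ) (noise p g) x)} ≤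
      s.card ^ 2 * Real.exp (-M ^ 2) := by
  have (e : Sym2 ι) := isProbabilityMeasure_bernoulliLaw (hp e)
  set μ := Measure.pi fun e => bernoulliLaw (p e)
  calc μ.real {g | ∃ x ∈ s, ∃ y ∈ s, M ≤ inner ℝ y (toEuclideanCLM (𝕜 := ℝ) (noise p g) x)}
      ≤ μ.real (⋃ q ∈ s ×ˢ s,
          {g | M ≤ inner ℝ q.2 (toEuclideanCLM (𝕜 := ℝ) (noise p g) q.1)}) := by
        refine measureReal_mono (fun g => ?_) (measure_ne_top _ _)
        rintro ⟨x, hx, y, hy, hxy⟩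
        exact Set.mem_biUnion (Finset.mk_mem_product hx hy) hxy
    _ ≤ ∑ q ∈ s ×ˢ s, μ.real {g | M ≤ inner ℝ q.2 (toEuclideanCLM (𝕜 := ℝ) (noise p g) q.1)} :=
        measureReal_biUnion_finset_le _ _
    _ ≤ ∑ q ∈ s ×ˢ s, Real.exp (-M ^ 2) := by
        refine Finset.sum_le_sum fun q hq => ?_
        obtain ⟨hq1, hq2⟩ := Finset.mem_product.1 hq
        exact measure_inner_noise_ge_le hp (hs _ hq1) (hs _ hq2) hM
    _ = s.card ^ 2 * Real.exp (-M ^ 2) := by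
        rw [Finset.sum_const, Finset.card_product, nsmul_eq_mul, Nat.cast_mul, sq (s.card : ℝ)]

theorem le_measure_opNorm_noise_le {p : Sym2 ι → ℝ} (hp : ∀ e, p e ∈ Set.Icc 0 1) {ζ : ℝ}
    (hζ : 0 ≤ ζ) :
    1 - Real.exp (-(ζ * Fintype.card ι)) ≤ (Measure.pi fun e => bernoulliLaw (p e)).real
      {g | ‖toEuclideanCLM (𝕜 := ℝ) (noise p g)‖ ≤ 4 * √((4 + ζ) * Fintype.card ι)} := by
  have (e : Sym2 ι) := isProbabilityMeasure_bernoulliLaw (hp e)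
  set μ := Measure.pi fun e => bernoulliLaw (p e)
  set N := Fintype.card ι
  set M : ℝ := √((4 + ζ) * N)
  have hM2 : M ^ 2 = (4 + ζ) * N := Real.sq_sqrt (by positivity)
  obtain ⟨s, hball, hcover, hcard⟩ := exists_isCover_closedBall_card_le (EuclideanSpace ℝ ι)
  rw [finrank_euclideanSpace] at hcard
  set bad := {g | ∃ x ∈ s, ∃ y ∈ s, M ≤ inner ℝ y (toEuclideanCLM (𝕜 := ℝ) (noise p g) x)}
  have hbad : μ.real bad ≤ Real.exp (-(ζ * N)) := by
    have hfive : (5 : ℝ) ≤ Real.exp 2 := by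
      have := Real.exp_one_gt_d9
      rw [show (2 : ℝ) = 1 + 1 by norm_num, Real.exp_add]
      nlinarith
    calc μ.real bad ≤ s.card ^ 2 * Real.exp (-M ^ 2) :=
          measure_exists_inner_noise_ge_le hp hball (Real.sqrt_nonneg _)
      _ ≤ (5 ^ N) ^ 2 * Real.exp (-M ^ 2) := by gcongr; exact_mod_cast hcard
      _ ≤ (Real.exp 2 ^ N) ^ 2 * Real.exp (-M ^ 2) := by gcongr
      _ = Real.exp (-(ζ * N)) := by
          rw [← pow_mul, ← Real.exp_nat_mul, ← Real.exp_add, hM2]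
          congr 1; push_cast; ring
  have hgood : badᶜ ⊆ {g | ‖toEuclideanCLM (𝕜 := ℝ) (noise p g)‖ ≤ 4 * M} := fun g hg =>
    opNorm_le_of_isCover hcover _ (Real.sqrt_nonneg _) fun x hx y hy =>
      (not_le.1 fun h => hg ⟨x, hx, y, hy, h⟩).le
  calc 1 - Real.exp (-(ζ * N)) ≤ 1 - μ.real bad := by gcongr
    _ = μ.real badᶜ := (probReal_compl_eq_one_sub (Set.toFinite bad).measurableSet).symm
    _ ≤ _ := measureReal_mono hgood

end NoiseNorm

namespace SBM

open scoped Matrix.Norms.Frobenius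

variable {r m n k : ℕ} {ρ α β γ η ζ τ : ℝ} {g : Graph r m n} {f : Node r m n → Fin k → ℝ}
  {b : Matrix (Fin k) (Fin r) ℝ}

section SpectralMatrices

open scoped Kronecker

/-- The matrix on the nodes that acts on the domains by `X` and on the classes by `Y`, and averages
over the nodes with the same domain and class. -/
noncomputable def blockMat (n : ℕ) (X : Matrix (Fin m) (Fin m) ℝ) (Y : Matrix (Fin r) (Fin r) ℝ) :
    Matrix (Node r m n) (Node r m n) ℝ :=
  X ⊗ₖ (Y ⊗ₖ avgMat (Fin n))

/-- The matrix on the nodes with eigenvalue `a` on constants, `c` on class contrasts, `d` on domain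
contrasts and `e` on interactions of class and domain, vanishing on vectors with mean zero for each
class and domain. -/
noncomputable def specMat (r m n : ℕ) (a c d e : ℝ) : Matrix (Node r m n) (Node r m n) ℝ :=
  a • blockMat n (avgMat _) (avgMat _) + c • blockMat n (avgMat _) (1 - avgMat _) +
    d • blockMat n (1 - avgMat _) (avgMat _) + e • blockMat n (1 - avgMat _) (1 - avgMat _)

theorem specMat_add (a c d e a' c' d' e' : ℝ) :
    specMat r m n a c d e + specMat r m n a' c' d' e' =
      specMat r m n (a + a') (c + c') (d + d') (e + e') := by
  simp only [specMat]
  module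

theorem smul_specMat (t a c d e : ℝ) :
    t • specMat r m n a c d e = specMat r m n (t * a) (t * c) (t * d) (t * e) := by
  simp only [specMat]
  module

theorem isSymm_specMat (a c d e : ℝ) : (specMat r m n a c d e).IsSymm := by
  have hblock (X : Matrix (Fin m) (Fin m) ℝ) (Y : Matrix (Fin r) (Fin r) ℝ) :
      (blockMat n X Y)ᵀ = blockMat n Xᵀ Yᵀ := rfl
  simp only [Matrix.IsSymm, specMat, transpose_add, transpose_smul, hblock, transpose_sub,
    transpose_one, isSymm_avgMat.eq]

theorem blockMat_apply (X : Matrix (Fin m) (Fin m) ℝ) (Y : Matrix (Fin r) (Fin r) ℝ)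
    (x x' : Node r m n) :
    blockMat n X Y x x' = X (dom x) (dom x') * (Y (cls x) (cls x') * (n : ℝ)⁻¹) := by
  change X (dom x) (dom x') * (Y (cls x) (cls x') * (Fintype.card (Fin n) : ℝ)⁻¹) = _
  rw [Fintype.card_fin]

theorem specMat_apply (a c d e : ℝ) (x x' : Node r m n) :
    specMat r m n a c d e x x' = (n : ℝ)⁻¹ * (
      a * ((m : ℝ)⁻¹ * (r : ℝ)⁻¹) +
      c * ((m : ℝ)⁻¹ * ((if cls x = cls x' then 1 else 0) - (r : ℝ)⁻¹)) +
      d * (((if dom x = dom x' then 1 else 0) - (m : ℝ)⁻¹) * (r : ℝ)⁻¹) +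
      e * (((if dom x = dom x' then 1 else 0) - (m : ℝ)⁻¹) *
        ((if cls x = cls x' then 1 else 0) - (r : ℝ)⁻¹))) := by
  simp only [specMat, Matrix.add_apply, Matrix.smul_apply, blockMat_apply, smul_eq_mul,
    Matrix.sub_apply, one_apply, avgMat, of_apply, Fintype.card_fin]
  ring

theorem blockMat_mulVec [NeZero n] (X : Matrix (Fin m) (Fin m) ℝ) (Y : Matrix (Fin r) (Fin r) ℝ)
    (p : Fin m → ℝ) (q : Fin r → ℝ) :
    (blockMat n X Y *ᵥ fun x => p (dom x) * q (cls x)) =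
      fun x => (X *ᵥ p) (dom x) * (Y *ᵥ q) (cls x) := by
  ext x
  simp only [mulVec, dotProduct, blockMat_apply, Fintype.sum_prod_type, Finset.sum_mul_sum]
  refine Finset.sum_congr rfl fun i _ => Finset.sum_congr rfl fun j _ => ?_
  have hn := NeZero.ne (n : ℝ)
  simp only [dom, cls, Finset.sum_const, Finset.card_univ, Fintype.card_fin, nsmul_eq_mul]
  field_simp

variable [NeZero r] [NeZero m] [NeZero n]

theorem specMat_mul (a c d e a' c' d' e' : ℝ) :
    specMat r m n a c d e * specMat r m n a' c' d' e' =
      specMat r m n (a * a') (c * c') (d * d') (e * e') := by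
  have hblock (X X' : Matrix (Fin m) (Fin m) ℝ) (Y Y' : Matrix (Fin r) (Fin r) ℝ) :
      blockMat n X Y * blockMat n X' Y' = blockMat n (X * X') (Y * Y') := by
    rw [blockMat, blockMat, ← mul_kronecker_mul, ← mul_kronecker_mul, isIdempotentElem_avgMat,
      blockMat]
  have hzero_left (Y : Matrix (Fin r) (Fin r) ℝ) :
      blockMat n (0 : Matrix (Fin m) (Fin m) ℝ) Y = 0 := zero_kronecker _
  have hzero_right (X : Matrix (Fin m) (Fin m) ℝ) :
      blockMat n X (0 : Matrix (Fin r) (Fin r) ℝ) = 0 := by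
    rw [blockMat, zero_kronecker, kronecker_zero]
  have hm : IsIdempotentElem (avgMat (Fin m)) := isIdempotentElem_avgMat
  have hr : IsIdempotentElem (avgMat (Fin r)) := isIdempotentElem_avgMat
  simp only [specMat, Matrix.mul_add, Matrix.add_mul, Matrix.smul_mul, Matrix.mul_smul, hblock,
    hm.eq, hr.eq, hm.one_sub.eq, hr.one_sub.eq, hm.mul_one_sub_self, hr.mul_one_sub_self,
    hm.one_sub_mul_self, hr.one_sub_mul_self, hzero_left, hzero_right]
  module

theorem trace_specMat (a c d e : ℝ) : trace (specMat r m n a c d e) =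
    a + c * (r - 1) + d * (m - 1) + e * ((m - 1) * (r - 1)) := by
  simp only [specMat, trace_add, trace_smul, blockMat, trace_kronecker, trace_avgMat, trace_sub,
    trace_one, Fintype.card_fin, smul_eq_mul]
  ring

theorem posSemidef_specMat {a c d e : ℝ} (ha : 0 ≤ a) (hc : 0 ≤ c) (hd : 0 ≤ d) (he : 0 ≤ e) :
    (specMat r m n a c d e).PosSemidef := by
  have hsqrt : (specMat r m n √a √c √d √e)ᴴ * specMat r m n √a √c √d √e =
      specMat r m n a c d e := by
    rw [conjTranspose_eq_transpose_of_trivial, isSymm_specMat, specMat_mul, Real.mul_self_sqrt ha,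
      Real.mul_self_sqrt hc, Real.mul_self_sqrt hd, Real.mul_self_sqrt he]
  exact hsqrt ▸ posSemidef_conjTranspose_mul_self _

theorem posSemidef_one_sub_specMat_one : (1 - specMat r m n 1 1 1 1).PosSemidef := by
  have hidem : IsIdempotentElem (1 - specMat r m n 1 1 1 1) :=
    IsIdempotentElem.one_sub (by simp only [IsIdempotentElem, specMat_mul, mul_one])
  have hsymm : (1 - specMat r m n 1 1 1 1)ᴴ = 1 - specMat r m n 1 1 1 1 := by
    rw [conjTranspose_eq_transpose_of_trivial, isSymm_one.sub (isSymm_specMat _ _ _ _)]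
  rw [← hidem, ← congrArg (· * (1 - specMat r m n 1 1 1 1)) hsymm]
  exact posSemidef_conjTranspose_mul_self _

theorem sum_specMat (a c d e : ℝ) :
    ∑ x, ∑ x', specMat r m n a c d e x x' = a * Fintype.card (Node r m n) := by
  have hone : specMat r m n a c d e *ᵥ (fun _ => 1) = fun _ => a := by
    have h (X : Matrix (Fin m) (Fin m) ℝ) (Y : Matrix (Fin r) (Fin r) ℝ) :=
      blockMat_mulVec (n := n) X Y (fun _ => 1) (fun _ => 1)
    simp only [mul_one] at h
    ext x
    simp [specMat, add_mulVec, smul_mulVec, h, sub_mulVec, avgMat_mulVec_const]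
  calc ∑ x, ∑ x', specMat r m n a c d e x x'
      = ∑ x, (specMat r m n a c d e *ᵥ fun _ => 1) x := by simp [mulVec, dotProduct]
    _ = a * Fintype.card (Node r m n) := by
      rw [hone, Finset.sum_const, Finset.card_univ, nsmul_eq_mul, mul_comm]

end SpectralMatrices

section Eigenvalues

/-- The standing assumptions on the edge probabilities: sharing the class or the domain makes an
edge more likely, and sharing both makes it most likely. -/
structure IsAssortative (ρ α β γ : ℝ) : Prop where
  nonneg : 0 ≤ γ
  le_one : ρ ≤ 1
  max_alpha_beta_lt : max α β < ρ
  lt_min_alpha_beta : γ < min α β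

/-- The smallest advantage `δ` in edge probability of sharing exactly one of class and domain over
sharing neither. -/
noncomputable def gap (α β γ : ℝ) : ℝ := min (α - γ) (β - γ)

/-- The eigenvalue on constants, divided by `n`, of the matrix of edge probabilities. -/
noncomputable def eigConst (r m : ℕ) (ρ α β γ : ℝ) : ℝ :=
  ρ + (m - 1) * α + (r - 1) * β + (r - 1) * (m - 1) * γ

/-- The eigenvalue on class contrasts, divided by `n`, of the matrix of edge probabilities. -/
noncomputable def eigClass (m : ℕ) (ρ α β γ : ℝ) : ℝ := (m - 1) * (α - γ) + (ρ - β)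

/-- The eigenvalue on domain contrasts, divided by `n`, of the matrix of edge probabilities. -/
noncomputable def eigDom (r : ℕ) (ρ α β γ : ℝ) : ℝ := (r - 1) * (β - γ) + (ρ - α)

/-- The eigenvalue on interactions of class and domain, divided by `n`, of the matrix of edge
probabilities. -/
def eigInter (ρ α β γ : ℝ) : ℝ := ρ - α - β + γ

namespace IsAssortative

variable (h : IsAssortative ρ α β γ)
include h

theorem alpha_lt : α < ρ := (max_lt_iff.1 h.max_alpha_beta_lt).1

theorem beta_lt : β < ρ := (max_lt_iff.1 h.max_alpha_beta_lt).2

theorem lt_alpha : γ < α := (lt_min_iff.1 h.lt_min_alpha_beta).1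

theorem lt_beta : γ < β := (lt_min_iff.1 h.lt_min_alpha_beta).2

theorem gap_pos : 0 < gap α β γ := lt_min (sub_pos.2 h.lt_alpha) (sub_pos.2 h.lt_beta)

theorem gap_le_one : gap α β γ ≤ 1 :=
  (min_le_left _ _).trans (by linarith [h.nonneg, h.alpha_lt, h.le_one])

theorem eigClass_pos [NeZero m] : 0 < eigClass m ρ α β γ := by
  have hm : (1 : ℝ) ≤ m := by exact_mod_cast NeZero.one_le
  exact add_pos_of_nonneg_of_pos
    (mul_nonneg (sub_nonneg.2 hm) (sub_pos.2 h.lt_alpha).le) (sub_pos.2 h.beta_lt)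

theorem eigDom_pos [NeZero r] : 0 < eigDom r ρ α β γ := by
  have hr : (1 : ℝ) ≤ r := by exact_mod_cast NeZero.one_le
  exact add_pos_of_nonneg_of_pos
    (mul_nonneg (sub_nonneg.2 hr) (sub_pos.2 h.lt_beta).le) (sub_pos.2 h.alpha_lt)

theorem eigClass_le_eigConst [NeZero m] :
    eigClass m ρ α β γ ≤ eigConst r m ρ α β γ := by
  have hm : (1 : ℝ) ≤ m := by exact_mod_cast NeZero.one_le
  have hdiff : eigConst r m ρ α β γ - eigClass m ρ α β γ = r * β + r * (m - 1) * γ := by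
    rw [eigConst, eigClass]
    ring
  have hβ : 0 ≤ r * β := mul_nonneg r.cast_nonneg (h.nonneg.trans h.lt_beta.le)
  have hγ : 0 ≤ r * (m - 1) * γ :=
    mul_nonneg (mul_nonneg r.cast_nonneg (sub_nonneg.2 hm)) h.nonneg
  linarith

theorem eigDom_le_eigConst [NeZero r] :
    eigDom r ρ α β γ ≤ eigConst r m ρ α β γ := by
  have hr : (1 : ℝ) ≤ r := by exact_mod_cast NeZero.one_le
  have hdiff : eigConst r m ρ α β γ - eigDom r ρ α β γ = m * α + m * (r - 1) * γ := by
    rw [eigConst, eigDom]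
    ring
  have hα : 0 ≤ m * α := mul_nonneg m.cast_nonneg (h.nonneg.trans h.lt_alpha.le)
  have hγ : 0 ≤ m * (r - 1) * γ :=
    mul_nonneg (mul_nonneg m.cast_nonneg (sub_nonneg.2 hr)) h.nonneg
  linarith

theorem eigConst_pos [NeZero m] : 0 < eigConst r m ρ α β γ :=
  h.eigClass_pos.trans_le h.eigClass_le_eigConst

theorem eigConst_le [NeZero r] [NeZero m] : eigConst r m ρ α β γ ≤ r * m * ρ := by
  have hr : (0 : ℝ) ≤ r - 1 := sub_nonneg.2 (by exact_mod_cast NeZero.one_le)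
  have hm : (0 : ℝ) ≤ m - 1 := sub_nonneg.2 (by exact_mod_cast NeZero.one_le)
  calc eigConst r m ρ α β γ ≤ ρ + (m - 1) * ρ + (r - 1) * ρ + (r - 1) * (m - 1) * ρ := by
        rw [eigConst]
        gcongr
        exacts [h.alpha_lt.le, h.beta_lt.le, (h.lt_alpha.trans h.alpha_lt).le]
    _ = r * m * ρ := by ring

theorem gap_le_eigClass (hm : 2 ≤ m) : gap α β γ ≤ eigClass m ρ α β γ := by
  have hm' : (2 : ℝ) ≤ m := by exact_mod_cast hm
  have hδ : gap α β γ ≤ α - γ := min_le_left _ _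
  have hβ := h.beta_lt
  have hα := h.lt_alpha
  rw [eigClass]
  nlinarith

theorem gap_le_eigDom (hr : 2 ≤ r) : gap α β γ ≤ eigDom r ρ α β γ := by
  have hr' : (2 : ℝ) ≤ r := by exact_mod_cast hr
  have hδ : gap α β γ ≤ β - γ := min_le_right _ _
  have hβ := h.lt_beta
  have hα := h.alpha_lt
  rw [eigDom]
  nlinarith

theorem gap_add_eigInter_le_eigClass [NeZero m] :
    gap α β γ + eigInter ρ α β γ ≤ eigClass m ρ α β γ := by
  have hm : (1 : ℝ) ≤ m := by exact_mod_cast NeZero.one_le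
  have hδ : gap α β γ ≤ m * (α - γ) :=
    (min_le_left _ _).trans (le_mul_of_one_le_left (sub_pos.2 h.lt_alpha).le hm)
  rw [eigClass, eigInter]
  linarith

theorem gap_add_eigInter_le_eigDom [NeZero r] :
    gap α β γ + eigInter ρ α β γ ≤ eigDom r ρ α β γ := by
  have hr : (1 : ℝ) ≤ r := by exact_mod_cast NeZero.one_le
  have hδ : gap α β γ ≤ r * (β - γ) :=
    (min_le_right _ _).trans (le_mul_of_one_le_left (sub_pos.2 h.lt_beta).le hr)
  rw [eigDom, eigInter]
  linarith

theorem gap_add_max_le (hr : 2 ≤ r) (hm : 2 ≤ m) :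
    gap α β γ + max (eigInter ρ α β γ) 0 ≤ min (eigClass m ρ α β γ) (eigDom r ρ α β γ) := by
  have : NeZero r := ⟨by omega⟩
  have : NeZero m := ⟨by omega⟩
  rw [← max_add_add_left, add_zero]
  exact max_le (le_min h.gap_add_eigInter_le_eigClass h.gap_add_eigInter_le_eigDom)
    (le_min (h.gap_le_eigClass hm) (h.gap_le_eigDom hr))

end IsAssortative

end Eigenvalues

section Signal

/-- The part of the matrix of edge probabilities that is orthogonal to the interactions of class and
domain. -/
noncomputable def signalMat (r m n : ℕ) (ρ α β γ : ℝ) : Matrix (Node r m n) (Node r m n) ℝ :=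
  specMat r m n (n * eigConst r m ρ α β γ) (n * eigClass m ρ α β γ) (n * eigDom r ρ α β γ) 0

theorem posSemidef_signalMat [NeZero r] [NeZero m] [NeZero n] (h : IsAssortative ρ α β γ) :
    (signalMat r m n ρ α β γ).PosSemidef :=
  posSemidef_specMat (mul_nonneg n.cast_nonneg h.eigConst_pos.le)
    (mul_nonneg n.cast_nonneg h.eigClass_pos.le) (mul_nonneg n.cast_nonneg h.eigDom_pos.le) le_rfl

variable [NeZero r] [NeZero m] [NeZero n]

theorem of_pairProb_eq (ρ α β γ : ℝ) : (of (pairProb ρ α β γ) : Matrix (Node r m n) _ ℝ) =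
    signalMat r m n ρ α β γ + specMat r m n 0 0 0 (n * eigInter ρ α β γ) := by
  have hr := NeZero.ne (r : ℝ)
  have hm := NeZero.ne (m : ℝ)
  have hn := NeZero.ne (n : ℝ)
  ext x x'
  rw [signalMat, specMat_add, specMat_apply, of_apply, pairProb, eigConst, eigClass, eigDom,
    eigInter]
  split_ifs <;> field_simp <;> ring

theorem isIdempotentElem_specMat_one_zero : IsIdempotentElem (specMat r m n 1 1 1 0) := by
  simp only [IsIdempotentElem, specMat_mul, mul_one, mul_zero]

theorem trace_specMat_one_zero (hk : k + 1 = r + m) : trace (specMat r m n 1 1 1 0) = k := by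
  have hk' : (k : ℝ) + 1 = r + m := by exact_mod_cast hk
  rw [trace_specMat]
  linarith

theorem specMat_one_zero_mul_signalMat :
    specMat r m n 1 1 1 0 * signalMat r m n ρ α β γ = signalMat r m n ρ α β γ := by
  simp only [signalMat, specMat_mul, one_mul, mul_zero]

theorem rank_signalMat_le (hk : k + 1 = r + m) : (signalMat r m n ρ α β γ).rank ≤ k := by
  have hrank : (specMat r m n 1 1 1 0).rank = k := by
    exact_mod_cast (rank_eq_trace_of_isIdempotentElem isIdempotentElem_specMat_one_zero).trans
      (trace_specMat_one_zero hk)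
  rw [← specMat_one_zero_mul_signalMat, ← hrank]
  exact rank_mul_le_left _ _

theorem trace_signalMat_transpose_mul_interaction (e : ℝ) :
    trace ((signalMat r m n ρ α β γ)ᵀ * specMat r m n 0 0 0 e) = 0 := by
  rw [signalMat, isSymm_specMat, specMat_mul, trace_specMat]
  ring

theorem posSemidef_signalMat_sq_sub {b : ℝ} (hb : 0 ≤ b) (hc : b ≤ eigClass m ρ α β γ)
    (hd : b ≤ eigDom r ρ α β γ) (hl : b ≤ eigConst r m ρ α β γ) :
    ((signalMat r m n ρ α β γ)ᵀ * signalMat r m n ρ α β γ -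
      (n * b) ^ 2 • specMat r m n 1 1 1 0).PosSemidef := by
  have hsq {x : ℝ} (hx : b ≤ x) : 0 ≤ n * x * (n * x) + -(n * b) ^ 2 * 1 := by
    nlinarith [pow_le_pow_left₀ (by positivity) (mul_le_mul_of_nonneg_left hx n.cast_nonneg) 2]
  rw [signalMat, isSymm_specMat, specMat_mul, sub_eq_add_neg, ← neg_smul, smul_specMat, specMat_add]
  exact posSemidef_specMat (hsq hl) (hsq hc) (hsq hd) (by simp)

theorem posSemidef_smul_one_sub_sub_interaction {a e : ℝ} (ha : 0 ≤ a) (hea : e ≤ a) :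
    (a • (1 - specMat r m n 1 1 1 0) - specMat r m n 0 0 0 e).PosSemidef := by
  have hdecomp : a • (1 - specMat r m n 1 1 1 0) - specMat r m n 0 0 0 e =
      a • (1 - specMat r m n 1 1 1 1) + specMat r m n 0 0 0 (a - e) := by
    simp only [specMat]
    module
  rw [hdecomp]
  exact (posSemidef_one_sub_specMat_one.smul ha).add
    (posSemidef_specMat le_rfl le_rfl le_rfl (sub_nonneg.2 hea))

theorem norm_signalMat_le (h : IsAssortative ρ α β γ) (hk : k + 1 = r + m) :
    ‖signalMat r m n ρ α β γ‖ ≤ √k * (n * eigConst r m ρ α β γ) := by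
  have hr : (0 : ℝ) ≤ r - 1 := sub_nonneg.2 (by exact_mod_cast NeZero.one_le)
  have hm : (0 : ℝ) ≤ m - 1 := sub_nonneg.2 (by exact_mod_cast NeZero.one_le)
  have hk' : (k : ℝ) + 1 = r + m := by exact_mod_cast hk
  have hc := mul_le_mul_of_nonneg_left (h.eigClass_le_eigConst (r := r) (m := m)) n.cast_nonneg
  have hd := mul_le_mul_of_nonneg_left (h.eigDom_le_eigConst (r := r) (m := m)) n.cast_nonneg
  have hc0 := mul_nonneg n.cast_nonneg (h.eigClass_pos (m := m)).le
  have hd0 := mul_nonneg n.cast_nonneg (h.eigDom_pos (r := r)).le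
  have hl0 := h.eigConst_pos (r := r) (m := m)
  refine le_of_sq_le_sq ?_ (by positivity)
  rw [frobenius_norm_sq_eq_trace, signalMat, isSymm_specMat, specMat_mul, trace_specMat,
    mul_pow, Real.sq_sqrt k.cast_nonneg]
  set l : ℝ := n * eigConst r m ρ α β γ
  calc _ ≤ l * l + l * l * (r - 1) + l * l * (m - 1) + 0 * 0 * ((m - 1) * (r - 1)) := by gcongr
    _ = k * l ^ 2 := by linear_combination (-l ^ 2) * hk'

end Signal

section Pretraining

/-- The matrix whose rows are the feature vectors. -/
def featMat (f : Node r m n → Fin k → ℝ) : Matrix (Node r m n) (Fin k) ℝ := of f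

/-- The Gram matrix of the features. -/
def gram (f : Node r m n → Fin k → ℝ) : Matrix (Node r m n) (Node r m n) ℝ :=
  featMat f * (featMat f)ᵀ

/-- The sum of the entries of the adjacency matrix, which normalizes the law of positive pairs. -/
def edgeMass (g : Graph r m n) : ℝ := ∑ z, ∑ z', adj g z z'

theorem contrastiveLoss_eq [NeZero r] [NeZero m] [NeZero n] (hs : 0 < edgeMass g)
    (f : Node r m n → Fin k → ℝ) : contrastiveLoss g f =
      ((edgeMass g)⁻¹ * Fintype.card (Node r m n)) ^ 2 *
        (‖(edgeMass g / (Fintype.card (Node r m n) : ℝ) ^ 2) • gram f - adj g‖ ^ 2 -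
          ‖adj g‖ ^ 2) := by
  simp only [contrastiveLoss, frobenius_norm_sq, Finset.mul_sum, ← Finset.sum_add_distrib,
    ← Finset.sum_sub_distrib]
  refine Finset.sum_congr rfl fun x _ => Finset.sum_congr rfl fun x' _ => ?_
  have hG : gram f x x' = f x ⬝ᵥ f x' := rfl
  rw [Matrix.sub_apply, Matrix.smul_apply, hG, smul_eq_mul, posPair, ← edgeMass]
  field_simp
  ring

theorem IsPretrained.norm_smul_gram_sub_adj_le [NeZero r] [NeZero m] [NeZero n]
    (hf : IsPretrained g f) (hs : 0 < edgeMass g) (V : Matrix (Node r m n) (Fin k) ℝ) :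
    ‖(edgeMass g / (Fintype.card (Node r m n) : ℝ) ^ 2) • gram f - adj g‖ ≤
      ‖V * Vᵀ - adj g‖ := by
  set t := edgeMass g / (Fintype.card (Node r m n) : ℝ) ^ 2
  have ht : 0 < t := div_pos hs (pow_pos (by exact_mod_cast Fintype.card_pos) 2)
  have hscaled : t • gram (of.symm (√t⁻¹ • V)) = V * Vᵀ := by
    change t • ((√t⁻¹ • V) * (√t⁻¹ • V)ᵀ) = V * Vᵀ
    rw [transpose_smul, Matrix.smul_mul, Matrix.mul_smul, smul_smul, smul_smul, mul_assoc,
      Real.mul_self_sqrt (by positivity), mul_inv_cancel₀ ht.ne', one_smul]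
  have hloss := hf (of.symm (√t⁻¹ • V))
  rw [contrastiveLoss_eq hs, contrastiveLoss_eq hs, mul_le_mul_iff_right₀ (by positivity),
    sub_le_sub_iff_right, hscaled] at hloss
  exact le_of_sq_le_sq hloss (norm_nonneg _)

theorem adj_eq (ρ α β γ : ℝ) (g : Graph r m n) :
    adj g = of (pairProb ρ α β γ) + noise (edgeProb ρ α β γ) g := by
  ext x x'
  change (if g s(x, x') then (1 : ℝ) else 0) =
    pairProb ρ α β γ x x' + ((if g s(x, x') then 1 else 0) - pairProb ρ α β γ x x')
  ring

theorem card_node : (Fintype.card (Node r m n) : ℝ) = r * m * n := by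
  simp only [Fintype.card_prod, Fintype.card_fin]
  push_cast
  ring

end Pretraining

section GramEstimate

variable [NeZero n]

theorem abs_edgeMass_sub_le [NeZero r] [NeZero m]
    (hg : ‖toEuclideanCLM (𝕜 := ℝ) (noise (edgeProb ρ α β γ) g)‖ ≤ τ) :
    |edgeMass g - n * eigConst r m ρ α β γ * Fintype.card (Node r m n)| ≤
      τ * Fintype.card (Node r m n) := by
  have hmass : edgeMass g = n * eigConst r m ρ α β γ * Fintype.card (Node r m n) +
      ∑ z, ∑ z', noise (edgeProb ρ α β γ) g z z' := by
    simp only [edgeMass, adj_eq ρ α β γ, of_pairProb_eq, signalMat, specMat_add, Matrix.add_apply,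
      Finset.sum_add_distrib, sum_specMat]
    ring
  rw [hmass, add_sub_cancel_left]
  exact (abs_sum_sum_le_opNorm _).trans (by gcongr)

theorem trace_smul_gram_transpose_mul_interaction_le [NeZero r] [NeZero m] {t : ℝ}
    (ht : 0 ≤ t) (f : Node r m n → Fin k → ℝ) (e : ℝ) :
    trace ((t • gram f)ᵀ * specMat r m n 0 0 0 (n * e)) ≤
      n * max e 0 * trace ((t • gram f)ᵀ * (1 - specMat r m n 1 1 1 0)) := by
  have hpsd : ((n * max e 0) • (1 - specMat r m n 1 1 1 0) -
      specMat r m n 0 0 0 (n * e)).PosSemidef :=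
    posSemidef_smul_one_sub_sub_interaction (by positivity) (by gcongr; exact le_max_left _ _)
  have hgram : (gram f)ᵀ = featMat f * (featMat f)ᵀ := by
    rw [gram, transpose_mul, transpose_transpose]
  have hnonneg := mul_nonneg ht (trace_mul_transpose_mul_nonneg (featMat f) hpsd)
  rw [← hgram, Matrix.mul_sub, trace_sub, Matrix.mul_smul, trace_smul, smul_eq_mul] at hnonneg
  rw [transpose_smul, Matrix.smul_mul, trace_smul, Matrix.smul_mul, trace_smul, smul_eq_mul,
    smul_eq_mul]
  linarith

theorem IsPretrained.gap_mul_norm_sub_signalMat_le (hf : IsPretrained g f) (hs : 0 < edgeMass g)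
    (h : IsAssortative ρ α β γ) (hr : 2 ≤ r) (hm : 2 ≤ m) (hk : k + 1 = r + m)
    (hg : ‖toEuclideanCLM (𝕜 := ℝ) (noise (edgeProb ρ α β γ) g)‖ ≤ τ) :
    gap α β γ * ‖(edgeMass g / (Fintype.card (Node r m n) : ℝ) ^ 2) • gram f -
      signalMat r m n ρ α β γ‖ ≤ 2 * eigConst r m ρ α β γ * (√(2 * k) * τ) := by
  have : NeZero r := ⟨by lia⟩
  have : NeZero m := ⟨by lia⟩
  set H := (edgeMass g / (Fintype.card (Node r m n) : ℝ) ^ 2) • gram f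
  set a := max (eigInter ρ α β γ) 0
  set b := min (eigClass m ρ α β γ) (eigDom r ρ α β γ)
  have hab : gap α β γ + a ≤ b := h.gap_add_max_le hr hm
  have hb : 0 ≤ b := (le_min h.eigClass_pos.le h.eigDom_pos.le)
  have hbl : b ≤ eigConst r m ρ α β γ := (min_le_left _ _).trans h.eigClass_le_eigConst
  have hHrank : H.rank ≤ k := by
    rw [show H = featMat f * (_ • (featMat f)ᵀ) from (Matrix.mul_smul _ _ _).symm]
    exact ((rank_mul_le_left _ _).trans (rank_le_card_width (featMat f))).trans_eq
      (Fintype.card_fin k)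
  obtain ⟨V, hV⟩ := exists_mul_transpose_eq (posSemidef_signalMat (n := n) h) (rank_signalMat_le hk)
  have hbest := norm_sub_le_of_best_approx (a := n * a) (b := n * b) hHrank
    (isSymm_specMat 1 1 1 0) isIdempotentElem_specMat_one_zero (trace_specMat_one_zero hk)
    specMat_one_zero_mul_signalMat (by positivity)
    (posSemidef_signalMat_sq_sub hb (min_le_left _ _) (min_le_right _ _) hbl)
    (trace_signalMat_transpose_mul_interaction _) (by positivity)
    (trace_smul_gram_transpose_mul_interaction_le (by positivity) f _) hg
    ((adj_eq ρ α β γ g).trans (congrArg (· + _) (of_pairProb_eq ρ α β γ)))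
    (hV ▸ hf.norm_smul_gram_sub_adj_le hs V)
  have hn : (0 : ℝ) < n := by exact_mod_cast NeZero.pos n
  refine le_of_mul_le_mul_left ?_ hn
  have hτ : 0 ≤ τ := (norm_nonneg _).trans hg
  calc n * (gap α β γ * ‖H - signalMat r m n ρ α β γ‖)
      ≤ (n * b - n * a) * ‖H - signalMat r m n ρ α β γ‖ := by
        rw [← mul_sub, ← mul_assoc]
        gcongr
        linarith
    _ ≤ 2 * (n * b) * (√(2 * k) * τ) := hbest
    _ ≤ 2 * (n * eigConst r m ρ α β γ) * (√(2 * k) * τ) := by gcongr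
    _ = n * (2 * eigConst r m ρ α β γ * (√(2 * k) * τ)) := by ring

theorem IsAssortative.edgeMass_pos [NeZero r] (h : IsAssortative ρ α β γ) (hm : 2 ≤ m)
    (hg : ‖toEuclideanCLM (𝕜 := ℝ) (noise (edgeProb ρ α β γ) g)‖ ≤ τ)
    (hτ : τ ≤ n * gap α β γ / 2) : 0 < edgeMass g := by
  have : NeZero m := ⟨by lia⟩
  have hn : (0 : ℝ) < n := by exact_mod_cast NeZero.pos n
  have hN : (0 : ℝ) < Fintype.card (Node r m n) := by exact_mod_cast Fintype.card_pos
  have hδl : gap α β γ ≤ eigConst r m ρ α β γ :=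
    (h.gap_le_eigClass hm).trans h.eigClass_le_eigConst
  have hτl : τ < n * eigConst r m ρ α β γ := by nlinarith [h.gap_pos]
  linarith [(abs_le.1 (abs_edgeMass_sub_le (m := m) hg)).1, mul_lt_mul_of_pos_right hτl hN]

theorem IsAssortative.abs_edgeMass_div_sub_le [NeZero r] [NeZero m] (h : IsAssortative ρ α β γ)
    (hg : ‖toEuclideanCLM (𝕜 := ℝ) (noise (edgeProb ρ α β γ) g)‖ ≤ τ) :
    |edgeMass g / (Fintype.card (Node r m n) : ℝ) ^ 2 - eigConst r m ρ α β γ / (r * m)| ≤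
      τ / (n * eigConst r m ρ α β γ) * (eigConst r m ρ α β γ / (r * m)) := by
  have hl := h.eigConst_pos (r := r) (m := m)
  have hn := NeZero.ne (n : ℝ)
  have hmass := abs_edgeMass_sub_le (m := m) hg
  rw [card_node] at hmass ⊢
  set l := eigConst r m ρ α β γ
  have hfrac : edgeMass g / (r * m * n) ^ 2 - l / (r * m) =
      (edgeMass g - n * l * (r * m * n)) / (r * m * n : ℝ) ^ 2 := by field_simp
  calc |edgeMass g / (r * m * n) ^ 2 - l / (r * m)|
      = |edgeMass g - n * l * (r * m * n)| / (r * m * n : ℝ) ^ 2 := by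
        rw [hfrac, abs_div, abs_of_nonneg (by positivity : (0 : ℝ) ≤ (r * m * n) ^ 2)]
    _ ≤ τ * (r * m * n) / (r * m * n : ℝ) ^ 2 := by gcongr
    _ = τ / (n * l) * (l / (r * m)) := by field_simp

theorem IsPretrained.norm_gram_sub_le (hf : IsPretrained g f)
    (h : IsAssortative ρ α β γ) (hr : 2 ≤ r) (hm : 2 ≤ m) (hk : k + 1 = r + m)
    (hg : ‖toEuclideanCLM (𝕜 := ℝ) (noise (edgeProb ρ α β γ) g)‖ ≤ τ)
    (hτ : τ ≤ n * gap α β γ / 2) :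
    ‖gram f - ((r * m) / eigConst r m ρ α β γ) • signalMat r m n ρ α β γ‖ ≤
      8 * (r * m) * √k * τ / gap α β γ := by
  have : NeZero r := ⟨by lia⟩
  have : NeZero m := ⟨by lia⟩
  have hn : (0 : ℝ) < n := by exact_mod_cast NeZero.pos n
  have hτ0 : 0 ≤ τ := (norm_nonneg _).trans hg
  have hδ := h.gap_pos
  have hl := h.eigConst_pos (r := r) (m := m)
  have hδl : gap α β γ ≤ eigConst r m ρ α β γ :=
    (h.gap_le_eigClass hm).trans h.eigClass_le_eigConst
  have hsignal := norm_signalMat_le (n := n) h hk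
  have hscale := h.abs_edgeMass_div_sub_le hg
  have hfit := hf.gap_mul_norm_sub_signalMat_le (h.edgeMass_pos hm hg hτ) h hr hm hk hg
  rw [← le_div_iff₀' hδ, Real.sqrt_mul zero_le_two] at hfit
  set l := eigConst r m ρ α β γ
  set δ := gap α β γ
  have hε : τ / (n * l) ≤ 1 / 2 := by
    rw [div_le_iff₀ (by positivity)]
    nlinarith
  have hsqrt : √2 ≤ 3 / 2 := Real.sqrt_le_iff.2 ⟨by norm_num, by norm_num⟩
  rw [← inv_div l]
  calc ‖gram f - (l / (r * m))⁻¹ • signalMat r m n ρ α β γ‖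
      ≤ 2 * (l / (r * m))⁻¹ * (2 * l * (√2 * √k * τ) / δ + τ / (n * l) * (√k * (n * l))) := by
        refine (norm_sub_inv_smul_le (by positivity) hε hscale).trans ?_
        gcongr
    _ = 2 * (r * m) * √k * τ * (2 * √2 / δ + 1 / l) := by field_simp
    _ ≤ 2 * (r * m) * √k * τ * (2 * (3 / 2) / δ + 1 / δ) := by gcongr
    _ = 8 * (r * m) * √k * τ / δ := by ring

end GramEstimate

section Labels

/-- The matrix whose rows are the mean-zero one-hot labels. -/
noncomputable def labelMat (r m n : ℕ) : Matrix (Node r m n) (Fin r) ℝ := of label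

/-- The projection that keeps the rows of the source nodes and deletes all other rows. -/
def sourceProj (r m n : ℕ) : Matrix (Node r m n) (Node r m n) ℝ :=
  diagonal fun x => if (dom x : ℕ) = 0 then 1 else 0

theorem isSymm_sourceProj : (sourceProj r m n).IsSymm := isSymm_diagonal _

theorem isIdempotentElem_sourceProj : IsIdempotentElem (sourceProj r m n) := by
  rw [IsIdempotentElem, sourceProj, diagonal_mul_diagonal]
  simp

theorem norm_sourceProj_mul_sq {κ : Type*} [Fintype κ] (X : Matrix (Node r m n) κ ℝ) :
    ‖sourceProj r m n * X‖ ^ 2 = ∑ x ∈ source r m n, ∑ i, X x i ^ 2 := by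
  rw [frobenius_norm_sq, source, Finset.sum_filter]
  refine Finset.sum_congr rfl fun x _ => ?_
  simp only [sourceProj, diagonal_mul]
  split_ifs <;> simp

theorem card_source [NeZero m] : (source r m n).card = r * n := by
  have hprod : source r m n = ({0} : Finset (Fin m)) ×ˢ Finset.univ := by
    ext x
    simp only [source, dom, Finset.mem_filter, Finset.mem_univ, true_and, Fin.val_eq_zero_iff,
      Finset.mem_product, Finset.mem_singleton, and_true]
  rw [hprod, Finset.card_product]
  simp

theorem le_card_target [NeZero r] (hm : 2 ≤ m) : n ≤ (target r m n).card := by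
  have hsub : ({⟨1, hm⟩} : Finset (Fin m)) ×ˢ (({0} : Finset (Fin r)) ×ˢ Finset.univ) ⊆
      target r m n := by
    intro x hx
    simp only [Finset.mem_product, Finset.mem_singleton] at hx
    rw [target, Finset.mem_filter, dom, hx.1]
    exact ⟨Finset.mem_univ _, one_ne_zero⟩
  simpa using Finset.card_le_card hsub

theorem sum_label (i : Fin r) : ∑ j : Fin r, ((if i = j then 1 else 0) - 1 / (r : ℝ)) = 0 := by
  have : NeZero r := ⟨i.pos.ne'⟩
  simp

theorem sum_sq_label_le (x : Node r m n) : ∑ i, label x i ^ 2 ≤ 1 := by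
  have hr : (0 : ℝ) < r := by exact_mod_cast (cls x).pos
  have hsq (i : Fin r) : label x i ^ 2 =
      (if i = cls x then 1 - 2 / (r : ℝ) else 0) + 1 / (r : ℝ) ^ 2 := by
    rw [label]
    split_ifs <;> ring
  have hsum : ∑ i, label x i ^ 2 = 1 - 1 / (r : ℝ) := by
    simp only [hsq, Finset.sum_add_distrib, Finset.sum_ite_eq', Finset.mem_univ, if_true,
      Finset.sum_const, Finset.card_univ, Fintype.card_fin, nsmul_eq_mul]
    field_simp
    ring
  rw [hsum]
  exact sub_le_self 1 (by positivity)

theorem norm_sourceProj_mul_labelMat_le [NeZero m] :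
    ‖sourceProj r m n * labelMat r m n‖ ≤ √(r * n) := by
  refine Real.le_sqrt_of_sq_le ?_
  calc ‖sourceProj r m n * labelMat r m n‖ ^ 2 = ∑ x ∈ source r m n, ∑ i, label x i ^ 2 :=
        norm_sourceProj_mul_sq _
    _ ≤ ∑ _ ∈ source r m n, (1 : ℝ) := Finset.sum_le_sum fun x _ => sum_sq_label_le x
    _ = r * n := by simp [card_source]

/- The labels restricted to the source are products of the indicator of the first domain and a
class contrast; the interaction eigenvalue has to vanish for the former to act as a constant. -/
theorem specMat_mul_source_label [NeZero m] [NeZero n] (a c d : ℝ) :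
    specMat r m n a c d 0 * (sourceProj r m n * labelMat r m n) = (c / m) • labelMat r m n := by
  ext x i
  set p : Fin m → ℝ := fun j => if (j : ℕ) = 0 then 1 else 0
  set q : Fin r → ℝ := fun j => (if i = j then 1 else 0) - 1 / (r : ℝ)
  have hcol : (fun x' => (sourceProj r m n * labelMat r m n) x' i) =
      fun x' => p (dom x') * q (cls x') := by
    ext x'
    rw [sourceProj, diagonal_mul]
    rfl
  have hp : avgMat (Fin m) *ᵥ p = fun _ => (m : ℝ)⁻¹ := by
    simp [avgMat_mulVec, p, Fin.val_eq_zero_iff]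
  have hq : avgMat (Fin r) *ᵥ q = 0 := by
    rw [avgMat_mulVec, sum_label, mul_zero]
    rfl
  calc (specMat r m n a c d 0 * (sourceProj r m n * labelMat r m n)) x i
      = (specMat r m n a c d 0 *ᵥ fun x' => (sourceProj r m n * labelMat r m n) x' i) x := rfl
    _ = c / m * q (cls x) := by
        rw [hcol]
        simp [specMat, add_mulVec, smul_mulVec, blockMat_mulVec, sub_mulVec, hp, hq]
        ring

end Labels

section Head

theorem featMat_mul_apply (f : Node r m n → Fin k → ℝ) (b : Matrix (Fin k) (Fin r) ℝ)
    (x : Node r m n) (i : Fin r) : (featMat f * b) x i = score f b x i := by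
  rw [score, mulVec_transpose]
  rfl

theorem headLoss_eq [NeZero m] (η : ℝ) (f : Node r m n → Fin k → ℝ)
    (b : Matrix (Fin k) (Fin r) ℝ) : headLoss η f b =
      ‖sourceProj r m n * (featMat f * b - labelMat r m n)‖ ^ 2 + η * (r * n) * ‖b‖ ^ 2 := by
  rw [headLoss, norm_sourceProj_mul_sq, Finset.sum_add_distrib, Finset.sum_const, card_source,
    frobenius_norm_sq b]
  simp only [Matrix.sub_apply, featMat_mul_apply, labelMat, of_apply]
  push_cast [nsmul_eq_mul]
  ring

theorem IsHead.norm_sub_smul_labelMat_le [NeZero r] [NeZero m] [NeZero n] (hb : IsHead η f b)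
    (hη : 0 < η) {K : Matrix (Node r m n) (Node r m n) ℝ} {θ : ℝ} (hθ : 0 ≤ θ)
    (hK : K * (sourceProj r m n * labelMat r m n) = θ • labelMat r m n) :
    ‖featMat f * b - (θ / (θ + η * (r * n))) • labelMat r m n‖ ≤
      ‖gram f - K‖ * √(r * n) / (η * (r * n)) * (1 + ‖gram f‖ / (η * (r * n))) := by
  have hr : (0 : ℝ) < r := by exact_mod_cast NeZero.pos r
  have hn : (0 : ℝ) < n := by exact_mod_cast NeZero.pos n
  refine (norm_ridge_sub_smul_le (by positivity) hθ isSymm_sourceProj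
    isIdempotentElem_sourceProj hK fun b' => ?_).trans ?_
  · rw [← headLoss_eq, ← headLoss_eq]
    exact hb b'
  · rw [← gram]
    gcongr
    exact norm_sourceProj_mul_labelMat_le

/-- The factor by which the learned head shrinks the labels. -/
noncomputable def shrinkage (r m : ℕ) (ρ α β γ η : ℝ) : ℝ :=
  eigClass m ρ α β γ / (eigClass m ρ α β γ + η * eigConst r m ρ α β γ)

theorem IsAssortative.shrinkage_mem [NeZero r] (h : IsAssortative ρ α β γ) {ε : ℝ}
    (hm : 2 ≤ m) (hη : 0 < η) (hηε : η ≤ (α - γ) * ε / (2 * r * ρ)) :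
    shrinkage r m ρ α β γ η ∈ Set.Icc (1 - ε) 1 := by
  have : NeZero m := ⟨by lia⟩
  have hr0 : (0 : ℝ) < r := by exact_mod_cast NeZero.pos r
  have hm2 : (2 : ℝ) ≤ m := by exact_mod_cast hm
  have hc := h.eigClass_pos (m := m)
  have hl := h.eigConst_pos (r := r) (m := m)
  have hα : 0 < α - γ := sub_pos.2 h.lt_alpha
  have hρ : 0 < ρ := h.nonneg.trans_lt (h.lt_alpha.trans h.alpha_lt)
  have hε : 0 < ε := by
    have := (le_div_iff₀ (by positivity)).1 hηε
    exact pos_of_mul_pos_right ((by positivity : 0 < η * (2 * r * ρ)).trans_le this) hα.le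
  have hratio : η * eigConst r m ρ α β γ ≤ ε * eigClass m ρ α β γ := by
    calc η * eigConst r m ρ α β γ ≤ (α - γ) * ε / (2 * r * ρ) * (r * m * ρ) := by
          gcongr
          exact h.eigConst_le
      _ = ε * (m / 2 * (α - γ)) := by field_simp
      _ ≤ ε * eigClass m ρ α β γ := by
          gcongr
          rw [eigClass]
          nlinarith [h.beta_lt]
  rw [shrinkage]
  refine ⟨(le_div_iff₀ (by positivity)).2 ?_, div_le_one_of_le₀ (by nlinarith) (by positivity)⟩
  nlinarith [mul_pos hε (mul_pos hη hl)]

theorem IsAssortative.le_one_of_half_le_shrinkage [NeZero m] (h : IsAssortative ρ α β γ)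
    (hη : 0 < η) (hξ : 1 / 2 ≤ shrinkage r m ρ α β γ η) : η ≤ 1 := by
  have hc := h.eigClass_pos (m := m)
  have hl := h.eigConst_pos (r := r) (m := m)
  rw [shrinkage, le_div_iff₀ (by positivity)] at hξ
  refine le_of_mul_le_mul_right ?_ hl
  linarith [h.eigClass_le_eigConst (r := r) (m := m)]

end Head

section Scores

theorem IsPretrained.norm_gram_le [NeZero n] (hf : IsPretrained g f)
    (h : IsAssortative ρ α β γ) (hr : 2 ≤ r) (hm : 2 ≤ m) (hk : k + 1 = r + m)
    (hg : ‖toEuclideanCLM (𝕜 := ℝ) (noise (edgeProb ρ α β γ) g)‖ ≤ τ)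
    (hτ : τ ≤ n * gap α β γ / 2) : ‖gram f‖ ≤ 5 * (r * m) * √k * n := by
  have : NeZero r := ⟨by lia⟩
  have : NeZero m := ⟨by lia⟩
  have hl := h.eigConst_pos (r := r) (m := m)
  have hδ := h.gap_pos
  have hsignal : ‖((r * m : ℝ) / eigConst r m ρ α β γ) • signalMat r m n ρ α β γ‖ ≤
      r * m * √k * n := by
    rw [norm_smul, Real.norm_of_nonneg (by positivity)]
    calc r * m / eigConst r m ρ α β γ * ‖signalMat r m n ρ α β γ‖
        ≤ r * m / eigConst r m ρ α β γ * (√k * (n * eigConst r m ρ α β γ)) := by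
          gcongr
          exact norm_signalMat_le h hk
      _ = r * m * √k * n := by field_simp
  calc ‖gram f‖ ≤ 8 * (r * m) * √k * τ / gap α β γ + r * m * √k * n :=
        (norm_le_norm_sub_add _ _).trans
          (add_le_add (hf.norm_gram_sub_le h hr hm hk hg hτ) hsignal)
    _ ≤ 8 * (r * m) * √k * (n * gap α β γ / 2) / gap α β γ + r * m * √k * n := by gcongr
    _ = 5 * (r * m) * √k * n := by field_simp; ring

theorem labelMat_eq_zero_of_subsingleton [Subsingleton (Fin r)] : labelMat r m n = 0 := by
  ext x i
  have : NeZero r := ⟨i.pos.ne'⟩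
  have hr : r = 1 := Fin.subsingleton_iff_le_one.1 inferInstance |>.antisymm NeZero.one_le
  simp [labelMat, label, Subsingleton.elim i (cls x), hr]

theorem IsHead.norm_sub_shrinkage_smul_labelMat_le [NeZero r] [NeZero n] (hb : IsHead η f b)
    (hf : IsPretrained g f) (h : IsAssortative ρ α β γ) (hm : 2 ≤ m) (hk : k + 1 = r + m)
    (hη : 0 < η) (hη1 : η ≤ 1)
    (hg : ‖toEuclideanCLM (𝕜 := ℝ) (noise (edgeProb ρ α β γ) g)‖ ≤ τ)
    (hτ : τ ≤ n * gap α β γ / 2) :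
    ‖featMat f * b - shrinkage r m ρ α β γ η • labelMat r m n‖ ≤
      48 * (r * m) ^ 3 * τ / (η ^ 2 * gap α β γ * √n) := by
  have : NeZero m := ⟨by lia⟩
  have hr1 : (1 : ℝ) ≤ r := by exact_mod_cast NeZero.one_le
  have hm1 : (1 : ℝ) ≤ m := by exact_mod_cast NeZero.one_le
  have hn : (0 : ℝ) < n := by exact_mod_cast NeZero.pos n
  have hδ := h.gap_pos
  have hτ0 : 0 ≤ τ := (norm_nonneg _).trans hg
  have hc := h.eigClass_pos (m := m)
  have hl := h.eigConst_pos (r := r) (m := m)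
  set θ : ℝ := r * n * eigClass m ρ α β γ / eigConst r m ρ α β γ with hθ
  have hθ0 : 0 ≤ θ := by positivity
  have hξ : shrinkage r m ρ α β γ η = θ / (θ + η * (r * n)) := by
    rw [hθ, shrinkage]
    field_simp
  rw [hξ]
  rcases (NeZero.one_le (n := r)).eq_or_lt with rfl | hr
  · refine (hb.norm_sub_smul_labelMat_le (K := gram f) hη hθ0
      (by simp [labelMat_eq_zero_of_subsingleton])).trans ?_
    rw [sub_self, norm_zero, zero_mul, zero_div, zero_mul]
    positivity
  · have hkq : √k ≤ √(r * m) := by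
      have hk' : (k : ℝ) + 1 = r + m := by exact_mod_cast hk
      exact Real.sqrt_le_sqrt (by nlinarith)
    have hK : ((r * m) / eigConst r m ρ α β γ) • signalMat r m n ρ α β γ *
        (sourceProj r m n * labelMat r m n) = θ • labelMat r m n := by
      rw [Matrix.smul_mul, signalMat, specMat_mul_source_label, smul_smul, hθ]
      congr 1
      field_simp
    refine (hb.norm_sub_smul_labelMat_le hη hθ0 hK).trans
      (ridge_bound_le (one_le_mul_of_one_le_of_one_le hr1 hm1) hr1 hn hη hη1 hδ (norm_nonneg _)
        ((hf.norm_gram_sub_le h hr hm hk hg hτ).trans ?_)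
        ((hf.norm_gram_le h hr hm hk hg hτ).trans ?_)) <;> gcongr

theorem IsHead.sum_score_sub_le [NeZero r] [NeZero n] (hb : IsHead η f b)
    (hf : IsPretrained g f) (h : IsAssortative ρ α β γ) (hm : 2 ≤ m) (hk : k + 1 = r + m)
    (hη : 0 < η) (hη1 : η ≤ 1) (hζ : 0 ≤ ζ) (hn : 64 * (4 + ζ) * (r * m / gap α β γ ^ 2) ≤ n)
    (hg : ‖toEuclideanCLM (𝕜 := ℝ) (noise (edgeProb ρ α β γ) g)‖ ≤ 4 * √((4 + ζ) * (r * m * n))) :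
    ∑ x ∈ target r m n, ∑ i, (score f b x i - shrinkage r m ρ α β γ η * label x i) ^ 2 ≤
      36864 * (4 + ζ) / (η ^ 4 * gap α β γ ^ 2) * (r * m) ^ 7 := by
  have hn0 : (0 : ℝ) < n := by exact_mod_cast NeZero.pos n
  have hδ := h.gap_pos
  have hτ : 4 * √((4 + ζ) * (r * m * n)) ≤ n * gap α β γ / 2 := by
    rw [← le_div_iff₀' four_pos]
    refine Real.sqrt_le_iff.2 ⟨by positivity, ?_⟩
    rw [← mul_div_assoc, div_le_iff₀ (by positivity)] at hn
    nlinarith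
  have hnorm := hb.norm_sub_shrinkage_smul_labelMat_le hf h hm hk hη hη1 hg hτ
  calc ∑ x ∈ target r m n, ∑ i, (score f b x i - shrinkage r m ρ α β γ η * label x i) ^ 2
      ≤ ∑ x, ∑ i, (score f b x i - shrinkage r m ρ α β γ η * label x i) ^ 2 :=
        Finset.sum_le_sum_of_subset_of_nonneg (Finset.subset_univ _)
          fun _ _ _ => Finset.sum_nonneg fun _ _ => sq_nonneg _
    _ = ‖featMat f * b - shrinkage r m ρ α β γ η • labelMat r m n‖ ^ 2 := by
        simp only [frobenius_norm_sq, Matrix.sub_apply, featMat_mul_apply]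
        rfl
    _ ≤ (48 * (r * m) ^ 3 * (4 * √((4 + ζ) * (r * m * n))) / (η ^ 2 * gap α β γ * √n)) ^ 2 := by
        gcongr
    _ = 36864 * (4 + ζ) / (η ^ 4 * gap α β γ ^ 2) * (r * m) ^ 7 := by
        rw [div_pow, mul_pow _ (√(n : ℝ)), mul_pow _ (4 * √_), mul_pow _ (√_),
          Real.sq_sqrt (by positivity), Real.sq_sqrt n.cast_nonneg]
        field_simp
        ring

theorem IsPredictor.card_errors_le {pred : Node r m n → Fin r} (h : IsPredictor f b pred)
    {ξ : ℝ} (hξ : 1 / 2 ≤ ξ) (s : Finset (Node r m n)) :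
    ((s.filter fun x => pred x ≠ cls x).card : ℝ) ≤
      8 * ∑ x ∈ s, ∑ i, (score f b x i - ξ * label x i) ^ 2 := by
  rw [Finset.card_filter, Finset.mul_sum, Nat.cast_sum]
  refine Finset.sum_le_sum fun x _ => ?_
  split_ifs with hx
  · have hpair : ∑ i ∈ {pred x, cls x}, (score f b x i - ξ * label x i) ^ 2 ≤
        ∑ i, (score f b x i - ξ * label x i) ^ 2 :=
      Finset.sum_le_sum_of_subset_of_nonneg (Finset.subset_univ _) fun _ _ _ => sq_nonneg _
    have hlabel : label x (cls x) = label x (pred x) + 1 := by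
      simp only [label, if_true, if_neg hx]
      ring
    have hscore := h x (cls x)
    rw [Finset.sum_pair hx, hlabel] at hpair
    push_cast
    nlinarith [sq_nonneg ((score f b x (pred x) - ξ * label x (pred x)) +
      (score f b x (cls x) - ξ * (label x (pred x) + 1)))]
  · push_cast
    positivity

theorem IsPredictor.targetError_le [NeZero r] [NeZero n] {pred : Node r m n → Fin r}
    (hpred : IsPredictor f b pred) (hb : IsHead η f b) (hf : IsPretrained g f)
    (h : IsAssortative ρ α β γ) (hm : 2 ≤ m) (hk : k + 1 = r + m) (hη : 0 < η)
    (hξ : 1 / 2 ≤ shrinkage r m ρ α β γ η) (hζ : 0 ≤ ζ)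
    (hn : 64 * (4 + ζ) * (r * m / gap α β γ ^ 2) ≤ n)
    (hg : ‖toEuclideanCLM (𝕜 := ℝ) (noise (edgeProb ρ α β γ) g)‖ ≤ 4 * √((4 + ζ) * (r * m * n))) :
    targetError pred ≤ 294912 * (4 + ζ) / (η ^ 4 * gap α β γ ^ 2 * n) * (r * m) ^ 7 := by
  have : NeZero m := ⟨by lia⟩
  have hn0 : (0 : ℝ) < n := by exact_mod_cast NeZero.pos n
  have hδ := h.gap_pos
  have hη1 := h.le_one_of_half_le_shrinkage hη hξ
  have hcard : (n : ℝ) ≤ (target r m n).card := by exact_mod_cast le_card_target hm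
  have herrors := (hpred.card_errors_le hξ (target r m n)).trans
    (mul_le_mul_of_nonneg_left (hb.sum_score_sub_le hf h hm hk hη hη1 hζ hn hg) (by norm_num))
  calc targetError pred
      ≤ 8 * (36864 * (4 + ζ) / (η ^ 4 * gap α β γ ^ 2) * (r * m) ^ 7) / n :=
        div_le_div₀ (by positivity) herrors hn0 hcard
    _ = 294912 * (4 + ζ) / (η ^ 4 * gap α β γ ^ 2 * n) * (r * m) ^ 7 := by field_simp; ring

end Scores

section Probability

theorem IsAssortative.edgeProb_mem (h : IsAssortative ρ α β γ) (e : Sym2 (Node r m n)) :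
    edgeProb ρ α β γ e ∈ Set.Icc 0 1 := by
  induction e with
  | h x y =>
    change pairProb ρ α β γ x y ∈ Set.Icc 0 1
    have hγ := h.nonneg
    have hρ := h.le_one
    have hα := h.lt_alpha
    have hβ := h.lt_beta
    have hαρ := h.alpha_lt
    have hβρ := h.beta_lt
    rw [pairProb]
    split_ifs <;> constructor <;> linarith

theorem IsAssortative.isProbabilityMeasure_graphLaw (h : IsAssortative ρ α β γ) :
    MeasureTheory.IsProbabilityMeasure (graphLaw r m n ρ α β γ) := by
  have (e : Sym2 (Node r m n)) := isProbabilityMeasure_bernoulliLaw (h.edgeProb_mem e)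
  rw [graphLaw]
  infer_instance

theorem IsAssortative.le_graphLaw_real [NeZero r] [NeZero m] [NeZero n]
    (h : IsAssortative ρ α β γ) (hζ : 0 ≤ ζ) {s : Set (Graph r m n)}
    (hs : ∀ g, ‖toEuclideanCLM (𝕜 := ℝ) (noise (edgeProb ρ α β γ) g)‖ ≤
      4 * √((4 + ζ) * (r * m * n)) → g ∈ s) :
    1 - (n : ℝ) ^ (-ζ) ≤ (graphLaw r m n ρ α β γ).real s := by
  have hprob := h.isProbabilityMeasure_graphLaw (r := r) (m := m) (n := n)
  have hnoise : _ ≤ (graphLaw r m n ρ α β γ).real _ :=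
    le_measure_opNorm_noise_le (ι := Node r m n) h.edgeProb_mem hζ
  rw [card_node] at hnoise
  have hr : (1 : ℝ) ≤ r := by exact_mod_cast NeZero.one_le
  have hm : (1 : ℝ) ≤ m := by exact_mod_cast NeZero.one_le
  have hn : (0 : ℝ) < n := by exact_mod_cast NeZero.pos n
  have hlog : Real.log n ≤ r * m * n := (Real.log_le_self hn.le).trans
    (le_mul_of_one_le_left hn.le (one_le_mul_of_one_le_of_one_le hr hm))
  have hexp : Real.exp (-(ζ * (r * m * n))) ≤ (n : ℝ) ^ (-ζ) := by
    rw [Real.rpow_def_of_pos hn, Real.exp_le_exp]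
    linarith [mul_le_mul_of_nonneg_left hlog hζ]
  calc 1 - (n : ℝ) ^ (-ζ) ≤ 1 - Real.exp (-(ζ * (r * m * n))) := sub_le_sub_left hexp 1
    _ ≤ _ := hnoise
    _ ≤ (graphLaw r m n ρ α β γ).real s := MeasureTheory.measureReal_mono fun g hg => hs g hg

theorem IsAssortative.le_graphLaw_real_targetError_le [NeZero r] (h : IsAssortative ρ α β γ)
    (hη : 0 < η) (hη' : η < (α - γ) / (8 * r * ρ)) (hn : 1000 * (r / gap α β γ ^ 2) ≤ n) :
    0.999 ≤ (graphLaw r 2 n ρ α β γ).real {g | ∀ f : Node r 2 n → Fin (r + 1) → ℝ,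
      IsPretrained g f → ∀ b : Matrix (Fin (r + 1)) (Fin r) ℝ, IsHead η f b →
        ∀ pred : Node r 2 n → Fin r, IsPredictor f b pred →
          targetError pred ≤ 294912 * 5 * 2 ^ 7 / (η ^ 4 * gap α β γ ^ 2 * n) * r ^ 7} := by
  have hr : (1 : ℝ) ≤ r := by exact_mod_cast NeZero.one_le
  have hratio : 1 ≤ r / gap α β γ ^ 2 :=
    (one_le_div₀ (pow_pos h.gap_pos 2)).2 ((pow_le_one₀ h.gap_pos.le h.gap_le_one).trans hr)
  have hn1000 : (1000 : ℝ) ≤ n := by linarith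
  have : NeZero n := ⟨by rintro rfl; norm_num at hn1000⟩
  have hη4 : η ≤ (α - γ) * (1 / 4) / (2 * r * ρ) := hη'.le.trans_eq (by field_simp; ring)
  have hξ := (h.shrinkage_mem le_rfl hη hη4).1
  have hn' : 64 * (4 + 1) * (r * (2 : ℕ) / gap α β γ ^ 2) ≤ n := by
    push_cast
    rw [mul_div_right_comm]
    linarith
  have hinv : (n : ℝ) ^ (-1 : ℝ) ≤ 1000⁻¹ := by
    rw [Real.rpow_neg_one]
    exact inv_anti₀ (by norm_num) hn1000
  refine le_trans (by linarith) (h.le_graphLaw_real zero_le_one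
    fun g hg f hf b hb pred hpred => ?_)
  refine (hpred.targetError_le hb hf h le_rfl rfl hη (by linarith) zero_le_one hn' hg).trans_eq ?_
  push_cast
  ring

end Probability

end SBM

theorem theorem1 :
    -- general case: `m` domains, feature dimension `r + m - 1`
    (∃ D : ℕ, ∀ ζ ε : ℝ, 0 < ζ → 0 < ε → ε < 1 / 2 →
      ∃ C₁ C₂ : ℝ, 0 < C₁ ∧ 0 < C₂ ∧
      ∀ r m : ℕ, 1 ≤ r → 2 ≤ m →
      ∀ ρ α β γ : ℝ, 0 ≤ γ → ρ ≤ 1 → max α β < ρ → γ < min α β →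
      ∀ η : ℝ, 0 < η → η ≤ (α - γ) * ε / (2 * r * ρ) →
      ∃ ξ : ℝ, 1 - ε ≤ ξ ∧ ξ ≤ 1 ∧
      ∀ n : ℕ, C₁ * (r * m / (min (α - γ) (β - γ)) ^ 2) ≤ n →
        1 - (n : ℝ) ^ (-ζ) ≤ (SBM.graphLaw r m n ρ α β γ).real
          {g | ∀ f : SBM.Node r m n → Fin (r + m - 1) → ℝ, SBM.IsPretrained g f →
            ∀ b : Matrix (Fin (r + m - 1)) (Fin r) ℝ, SBM.IsHead η f b →
              ∑ x ∈ SBM.target r m n, ∑ i, (SBM.score f b x i - ξ * SBM.label x i) ^ 2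
                  ≤ C₂ / (η ^ 4 * (min (α - γ) (β - γ)) ^ 2) * ((r : ℝ) * m) ^ D ∧
              ∀ pred : SBM.Node r m n → Fin r, SBM.IsPredictor f b pred →
                SBM.targetError pred
                  ≤ C₂ / (η ^ 4 * (min (α - γ) (β - γ)) ^ 2 * n) * ((r : ℝ) * m) ^ D}) ∧
    -- two domains, feature dimension `r + 1`, probability `0.999`
    (∃ (D : ℕ) (C₁ C₂ : ℝ), 0 < C₁ ∧ 0 < C₂ ∧
      ∀ r : ℕ, 1 ≤ r →
      ∀ ρ α β γ : ℝ, 0 ≤ γ → ρ ≤ 1 → max α β < ρ → γ < min α β →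
      ∀ η : ℝ, 0 < η → η < (α - γ) / (8 * r * ρ) →
      ∀ n : ℕ, C₁ * (r / (min (α - γ) (β - γ)) ^ 2) ≤ n →
        0.999 ≤ (SBM.graphLaw r 2 n ρ α β γ).real
          {g | ∀ f : SBM.Node r 2 n → Fin (r + 1) → ℝ, SBM.IsPretrained g f →
            ∀ b : Matrix (Fin (r + 1)) (Fin r) ℝ, SBM.IsHead η f b →
              ∀ pred : SBM.Node r 2 n → Fin r, SBM.IsPredictor f b pred →
                SBM.targetError pred
                  ≤ C₂ / (η ^ 4 * (min α β - γ) ^ 2 * n) * (r : ℝ) ^ D}) := by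
  refine ⟨⟨7, fun ζ ε hζ _ hε => ⟨64 * (4 + ζ), 294912 * (4 + ζ), by positivity, by positivity,
    fun r m hr hm ρ α β γ hγ hρ hmax hmin η hη hηε => ?_⟩⟩,
    7, 1000, 294912 * 5 * 2 ^ 7, by norm_num, by norm_num,
    fun r hr ρ α β γ hγ hρ hmax hmin η hη hη' n hn => ?_⟩
  · have h : SBM.IsAssortative ρ α β γ := ⟨hγ, hρ, hmax, hmin⟩
    have : NeZero r := ⟨by lia⟩
    have : NeZero m := ⟨by lia⟩
    obtain ⟨hξ, hξ1⟩ := h.shrinkage_mem hm hη hηε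
    have hξ2 : 1 / 2 ≤ SBM.shrinkage r m ρ α β γ η := by linarith
    refine ⟨_, hξ, hξ1, fun n hn => ?_⟩
    have hδ : 0 < min (α - γ) (β - γ) := h.gap_pos
    have : NeZero n := ⟨Nat.cast_ne_zero.1 (hn.trans_lt' (by positivity)).ne'⟩
    have hη1 := h.le_one_of_half_le_shrinkage hη hξ2
    refine h.le_graphLaw_real hζ.le fun g hg f hf b hb => ⟨?_, fun pred hpred => ?_⟩
    · refine (hb.sum_score_sub_le hf h hm (by lia) hη hη1 hζ.le hn hg).trans ?_
      rw [SBM.gap]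
      gcongr
      norm_num
    · exact hpred.targetError_le hb hf h hm (by lia) hη hξ2 hζ.le hn hg
  · have : NeZero r := ⟨by lia⟩
    rw [← min_sub_sub_right]
    exact SBM.IsAssortative.le_graphLaw_real_targetError_le ⟨hγ, hρ, hmax, hmin⟩ hη hη' hn
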